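/- **Setting.** Consider the concurrent heap-manipulating language with labeled statements $$s ::= \mathbf{skip}\mid x:=\mathbf{new}()\mid x:={*e}\mid {*x}:=e\mid c:=\mathsf{CoreAlloc}(\bar e)\mid \bar r:=\mathsf{CoreApi}_k(c,\bar e)\mid s_1;s_2\mid \mathsf{fork}(\bar x)\{s\},$$ in SSA form (every variable is assigned at most once, and not at or after a use); all statements except $s_1;s_2$ and $\mathsf{fork}$ are *simple*. The Core statements are opaque: they are run by an arbitrary small-step implementation of the Core. Each thread has its own variables and two ghost sets, $\mathsf{slh}$ (local heap locations) and $\mathsf{sih}$ (Core instances); the shared memory has two ghost cells, $\mathsf{sgh}$ (holding a set of heap locations) and $\mathsf{used}$ (holding a boolean). Assertions are those of an intuitionistic separation logic with fractional permissions; $\mathsf{acc}(x)$ is full permission to the location to which $x$ points, $\mathsf{acc}_{\mathrm{nil}}(x)$ is $x\neq\mathbf{nil}\Rightarrow\mathsf{acc}(x)$, $\mathsf{inv}_{\mathrm{nil}}(x)$ is $x\ne\mathbf{nil}\Rightarrow \mathsf{inv}(x)$, and $\mathsf{acc}_{\mathrm{nil}}(\bar x)$ is the iterated separating conjunction. Let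 $\phi$ (the I/O specification) and $\mathsf{inv}(\cdot)$ (the Core invariant) be arbitrary assertions. **Invariants.** $\Pi_l=\bigl(\bigstar_{l\in\mathsf{slh}}\mathsf{acc}(l)\bigr)\star\bigl(\bigstar_{i\in\mathsf{sih}}\mathsf{inv}(i)\bigr)$ and $\Pi_g=\mathsf{acc}(\mathsf{sgh})\star\bigl(\bigstar_{g\in{*\mathsf{sgh}}}\mathsf{acc}(g)\bigr)\star\mathsf{acc}(\mathsf{used})\star(\neg{*\mathsf{used}}\Rightarrow\phi)$. **Instrumentation $\mathbb A$.** Here $\cup_{\rm nil}$ and $\setminus$ ignore values that are not heap locations, $\langle\cdot\rangle$ is an atomic block, and $D$ is a thread-local ghost variable. * $\mathbb A(\mathbf{skip})=\mathbf{skip}$; $\mathbb A(x:=\mathbf{new}())$ is $x:=\mathbf{new}();\ \mathsf{slh}:=\mathsf{slh}\cup_{\rm nil}\{x\}$. * $\mathbb A(x:={*e})$ is $\mathsf{slh}:=\mathsf{slh}\setminus\{e\};\ x:={*e};\ \mathsf{slh}:=\mathsf{slh}\cup_{\rm nil}\{e\}$ if $e\in\mathsf{slh}$, and otherwise $\langle{*\mathsf{sgh}}:={*\mathsf{sgh}}\setminus\{e\};\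 x:={*e};\ {*\mathsf{sgh}}:={*\mathsf{sgh}}\cup_{\rm nil}\{e\}\rangle$. * $\mathbb A({*x}:=e)$ is $\mathsf{slh}:=\mathsf{slh}\setminus\{x\};\ {*x}:=e;\ \mathsf{slh}:=\mathsf{slh}\cup_{\rm nil}\{x\}$ if $x\in\mathsf{slh}$, and otherwise $\langle{*\mathsf{sgh}}:={*\mathsf{sgh}}\setminus\{x\};\ D:=\mathsf{reach}(e)\cap\mathsf{slh};\ \mathsf{slh}:=\mathsf{slh}\setminus D;\ {*x}:=e;\ {*\mathsf{sgh}}:={*\mathsf{sgh}}\cup_{\rm nil}(\{x\}\cup D)\rangle$. * $\mathbb A(c:=\mathsf{CoreAlloc}(\bar e))$ is $\langle{*\mathsf{used}}:=\mathsf{true}\rangle;\ \mathsf{slh}:=\mathsf{slh}\setminus\bar e;\ c:=\mathsf{CoreAlloc}(\bar e);\ \mathsf{slh}:=\mathsf{slh}\cup_{\rm nil}\bar e;\ \mathsf{sih}:=\mathsf{sih}\cup_{\rm nil}\{c\}$. * $\mathbb A(\bar r:=\mathsf{CoreApi}_k(c,\bar e))$ is $\mathsf{sih}:=\mathsf{sih}\setminus\{c\};\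 \mathsf{slh}:=\mathsf{slh}\setminus\bar e;\ \bar r:=\mathsf{CoreApi}_k(c,\bar e);\ \mathsf{slh}:=\mathsf{slh}\cup_{\rm nil}(\bar e\cup\bar r);\ \mathsf{sih}:=\mathsf{sih}\cup_{\rm nil}\{c\}$. * $\mathbb A(s_1;s_2)=\mathbb A(s_1);\mathbb A(s_2)$. * $\mathbb A(\mathsf{fork}(\bar x)\{s\})$ is $D:=\mathsf{reach}(\bar x)\cap\mathsf{slh};\ \mathsf{slh}:=\mathsf{slh}\setminus D;\ \langle{*\mathsf{sgh}}:={*\mathsf{sgh}}\cup_{\rm nil}D\rangle;\ \mathsf{fork}(\bar x)\{\mathsf{slh}:=\emptyset;\ \mathsf{sih}:=\emptyset;\ \mathbb A(s)\}$. **Side conditions.** Fix any set $\mathcal T$ of traces (finite interleaved executions of pools of threads; for instance, all executions of the instrumented codebase that contains $s$). $\omega(s)$ says that, on all traces in $\mathcal T$, whenever a thread is at the program point before $s$: for $x:={*e}$, $e\in\mathsf{slh}\cup{*\mathsf{sgh}}$; for ${*x}:=e$, $x\in\mathsf{slh}\cup{*\mathsf{sgh}}$; for $\mathsf{CoreAlloc}(\bar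 e)$, ${*\mathsf{used}}=\mathsf{false}$, the non-nil $\bar e$ lie in $\mathsf{slh}$, and no two of them are equal; for $\mathsf{CoreApi}_k(c,\bar e)$, the non-nil $\bar e$ lie in $\mathsf{slh}$, no two of them are equal, and $c\in\mathsf{sih}$ or $c=\mathbf{nil}$ (arguments that are plain data rather than pointers are treated like $\mathbf{nil}$ here and in $\mathsf{acc}_{\mathrm{nil}}$). It is true for the other statements. **Proof rules.** *Simple*: if $s$ is simple and $\omega(s)$ holds, then $\Pi_g\vdash\{\Pi_l\}\,\mathbb A(s)\,\{\Pi_l\}$. *Seq*: from this judgment for $s_1$ and for $s_2$, infer it for $s_1;s_2$. *Fork*: from this judgment for $s$, infer it for $\mathsf{fork}(\bar x)\{s\}$. **Core.** Assume that the Core has been verified: for each Core statement in $s$ the triple $\Pi_g\models\{\phi\star R\}\ c:=\mathsf{CoreAlloc}(\bar e)\ \{\mathsf{inv}(c)\star R'\}$, resp. $\Pi_g\models\{\mathsf{inv}_{\mathrm{nil}}(c)\star S_k\}\ \bar r:=\mathsf{CoreApi}_k(c,\bar e)\ \{\mathsf{inv}_{\mathrm{nil}}(c)\star S'_k\}$,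 holds, where $R$ and $S_k$ consist of (possibly partial) permissions for the non-nil $\bar e$, with $\mathsf{acc}_{\mathrm{nil}}(\bar e)\models R$ and $\mathsf{acc}_{\mathrm{nil}}(\bar e)\models S_k$, and where $R'\models R$ and $S'_k\models S_k\star\mathsf{acc}_{\mathrm{nil}}(\bar r)$. **Semantic triples.** $J\models\{P\}\,C\,\{Q\}$ means that for every $n$, every thread with remaining command $C$ whose store and owned heap satisfy $P$ is safe for $n$ steps: if it has terminated then $Q$ holds; and whenever the whole memory is composed of the owned heap, a heap satisfying the shared resource invariant $J$, and an arbitrary frame, and (if $C$ is about to start a labeled statement) the current store and memory occur at that program point on some trace in $\mathcal T$, then $C$ does not fault, its non-atomic accesses are covered by owned permissions, and after any step the memory is again composed of an owned heap with which the thread is safe for $n-1$ steps (with postcondition $Q$), a heap with which a newly spawned thread, if any, is safe for $n-1$ steps (with postcondition true), a heap satisfying $J$, and the unchanged frame. **Theorem (soundness of the proof rules).** For every set $\mathcal T$ of traces and every statement $s$ in SSA form whose Core statements have been verified as above: if the rules derive $\Pi_g\vdash\{\Pi_l\}\,\mathbb A(s)\,\{\Pi_l\}$, then $\Pi_g\models\{\Pi_l\}\,\mathbb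 A(s)\,\{\Pi_l\}$. -/

import Mathlib

universe u

namespace CoreApp

/-! ### Values, expressions, memory -/

abbrev Var := ℕ
abbrev Addr := ℕ
abbrev Label := ℕ

/-- Run-time values: the null pointer, plain data, and pointers to heap locations. -/
inductive Val where
  | nil
  | int (z : ℤ)
  | loc (a : Addr)

/-- The heap location a value points to, if there is one. -/
def Val.addr? : Val → Option Addr
  | .loc a => some a
  | _ => none

/-- Side-effect-free expressions, with arbitrary pure operators. -/
inductive Expr where
  | var (x : Var)
  | const (v : Val)
  | un (f : Val → Val) (e : Expr)
  | bin (f : Val → Val → Val) (e₁ e₂ : Expr)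

def Expr.fv : Expr → Set Var
  | .var x => {x}
  | .const _ => ∅
  | .un _ e => e.fv
  | .bin _ e₁ e₂ => e₁.fv ∪ e₂.fv

/-- The free variables of a list of expressions. -/
def fvs (es : List Expr) : Set Var := {x | ∃ e ∈ es, x ∈ e.fv}

/-- Memory cells: ordinary heap locations, the two global ghost cells `sgh` and `used`, and ghost
cells in which I/O permissions live. -/
inductive Loc where
  | addr (a : Addr)
  | sgh
  | used
  | io (t : ℕ)
  deriving DecidableEq

/-- The type of the content of a cell. -/
def Loc.Cell : Loc → Type
  | .addr _ => Val
  | .sgh => Finset Addr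
  | .used => Bool
  | .io _ => Val

/-- The memory shared by all threads (including the ghost cells). -/
abbrev Mem := (l : Loc) → Option l.Cell

/-- The store of a single thread: its variables, and its ghost sets `slh` (local heap locations)
and `sih` (Core instances). The ghost variable `tmp` holds the set of locations that are about to
escape from the thread. -/
structure Store where
  vars : Var → Val
  slh : Finset Addr
  sih : Finset Addr
  tmp : Finset Addr

def Store.init : Store := ⟨fun _ => .nil, ∅, ∅, ∅⟩

def Expr.eval (σ : Store) : Expr → Val
  | .var x => σ.vars x
  | .const v => v
  | .un f e => f (e.eval σ)
  | .bin f e₁ e₂ => f (e₁.eval σ) (e₂.eval σ)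

def evals (σ : Store) (es : List Expr) : List Val := es.map (Expr.eval σ)

def Store.set (σ : Store) (x : Var) (v : Val) : Store :=
  { σ with vars := Function.update σ.vars x v }

/-- Simultaneous assignment of a list of values to a list of variables. -/
def Store.sets (σ : Store) : List Var → List Val → Store
  | x :: xs, v :: vs => (σ.set x v).sets xs vs
  | _, _ => σ

open Classical in
/-- The store of a new thread, to which the variables `xs` are passed. -/
noncomputable def Store.child (σ : Store) (xs : List Var) : Store :=
  { σ with vars := fun x => if x ∈ xs then σ.vars x else .nil }

/-- The set of heap locations denoted by a list of values; `nil` and plain data are ignored. -/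
def addrs (vs : List Val) : Finset Addr := (vs.filterMap Val.addr?).toFinset

/-- `b` is the pointer stored in location `a`. -/
def PointsTo (m : Mem) (a b : Addr) : Prop := m (.addr a) = some (Val.loc b)

/-- The heap locations transitively reachable from a list of values. -/
def reachable (m : Mem) (vs : List Val) : Set Addr :=
  {b | ∃ a ∈ addrs vs, Relation.ReflTransGen (PointsTo m) a b}

/-- The ghost set stored in the cell `sgh`. -/
def sghSet (m : Mem) : Finset Addr :=
  match (m .sgh : Option (Finset Addr)) with
  | some S => S
  | none => ∅

/-! ### The source language -/

/-- Statements of the programming language. Every statement carries a label, its first argument. -/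
inductive Stmt where
  | skip (ℓ : Label)
  /-- `x := new()` -/
  | alloc (ℓ : Label) (x : Var)
  /-- `x := *e` -/
  | read (ℓ : Label) (x : Var) (e : Expr)
  /-- `*x := e` -/
  | write (ℓ : Label) (x : Var) (e : Expr)
  /-- `c := CoreAlloc(es)`, the constructor of the Core -/
  | coreAlloc (ℓ : Label) (c : Var) (es : List Expr)
  /-- `rs := CoreApi_k(c, es)`, the `k`-th API function of the Core -/
  | coreCall (ℓ : Label) (k : ℕ) (c : Var) (es : List Expr) (rs : List Var)
  | seq (ℓ : Label) (s₁ s₂ : Stmt)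
  /-- `fork(xs) { s }` -/
  | fork (ℓ : Label) (xs : List Var) (s : Stmt)

def Stmt.label : Stmt → Label
  | .skip ℓ | .alloc ℓ _ | .read ℓ _ _ | .write ℓ _ _ | .coreAlloc ℓ _ _
  | .coreCall ℓ _ _ _ _ | .seq ℓ _ _ | .fork ℓ _ _ => ℓ

/-- All statements except sequential composition and fork. -/
def Stmt.IsSimple : Stmt → Prop
  | .seq _ _ _ | .fork _ _ _ => False
  | _ => True

/-- The variables that a statement assigns. -/
def Stmt.defs : Stmt → Set Var
  | .skip _ | .write _ _ _ => ∅
  | .alloc _ x | .read _ x _ => {x}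
  | .coreAlloc _ c _ => {c}
  | .coreCall _ _ _ _ rs => {r | r ∈ rs}
  | .seq _ s₁ s₂ => s₁.defs ∪ s₂.defs
  | .fork _ _ s => s.defs

/-- The variables that a statement uses. -/
def Stmt.uses : Stmt → Set Var
  | .skip _ | .alloc _ _ => ∅
  | .read _ _ e => e.fv
  | .write _ x e => {x} ∪ e.fv
  | .coreAlloc _ _ es => fvs es
  | .coreCall _ _ c es _ => {c} ∪ fvs es
  | .seq _ s₁ s₂ => s₁.uses ∪ s₂.uses
  | .fork _ xs s => {x | x ∈ xs} ∪ s.uses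

/-- Static single assignment form: every variable is assigned at most once in the program text, and
never at or after a place where it is used. -/
def Stmt.IsSSA : Stmt → Prop
  | .seq _ s₁ s₂ => s₁.IsSSA ∧ s₂.IsSSA ∧ Disjoint s₂.defs (s₁.defs ∪ s₁.uses)
  | .fork _ xs s => s.IsSSA ∧ Disjoint s.defs {x | x ∈ xs}
  | .coreCall ℓ k c es rs =>
      rs.Nodup ∧ Disjoint (Stmt.coreCall ℓ k c es rs).defs (Stmt.coreCall ℓ k c es rs).uses
  | s => Disjoint s.defs s.uses

/-! ### The Core -/

/-- An arbitrary implementation of the Core, as a small-step transition system on the shared memory.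
`K` is the type of control states of a running Core invocation. A step may spawn a further Core
thread (the last argument of `step`); `reads` and `writes` are the cells that the next step accesses
non-atomically. -/
structure CoreImpl (K : Type u) where
  /-- the constructor is invoked with the given arguments -/
  alloc : List Val → K
  /-- the `k`-th API function is invoked on an instance, with the given arguments -/
  call : ℕ → Val → List Val → K
  step : K → Mem → K → Mem → Option K → Prop
  /-- the invocation returns these results -/
  result : K → List Val → Prop
  fault : K → Mem → Prop
  reads : K → Set Loc
  writes : K → Set Loc

/-! ### The instrumented language -/

/-- Ghost expressions denoting sets of heap locations. -/
inductive GSet where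
  | empty
  | slh
  | sih
  | tmp
  /-- the set of the locations that these expressions point to -/
  | vals (es : List Expr)
  /-- `reachable(es) ∩ slh` -/
  | reachSlh (es : List Expr)
  | union (A B : GSet)
  | diff (A B : GSet)

open Classical in
noncomputable def GSet.eval (σ : Store) (m : Mem) : GSet → Finset Addr
  | .empty => ∅
  | .slh => σ.slh
  | .sih => σ.sih
  | .tmp => σ.tmp
  | .vals es => addrs (evals σ es)
  | .reachSlh es => σ.slh.filter (fun a => a ∈ reachable m (evals σ es))
  | .union A B => A.eval σ m ∪ B.eval σ m
  | .diff A B => A.eval σ m \ B.eval σ m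

/-- Primitive commands. -/
inductive Act where
  | alloc (x : Var)
  | read (x : Var) (e : Expr)
  | write (x : Var) (e : Expr)
  /-- `slh := A` -/
  | setSlh (A : GSet)
  /-- `sih := A` -/
  | setSih (A : GSet)
  /-- `tmp := A` -/
  | setTmp (A : GSet)
  /-- `*sgh := *sgh ∪ A` -/
  | sghAdd (A : GSet)
  /-- `*sgh := *sgh \ A` -/
  | sghRem (A : GSet)
  /-- `*used := true` -/
  | setUsed

/-- `a.Run σ m σ' m'`: executing `a` in store `σ` and memory `m` may result in `σ'` and `m'`. -/
def Act.Run : Act → Store → Mem → Store → Mem → Prop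
  | .alloc x, σ, m, σ', m' => ∃ a : Addr, m (.addr a) = none ∧ σ' = σ.set x (.loc a) ∧
      m' = Function.update m (.addr a) (some Val.nil)
  | .read x e, σ, m, σ', m' => ∃ (a : Addr) (v : Val), e.eval σ = .loc a ∧
      m (.addr a) = some v ∧ σ' = σ.set x v ∧ m' = m
  | .write x e, σ, m, σ', m' => ∃ a : Addr, σ.vars x = .loc a ∧ m (.addr a) ≠ none ∧
      σ' = σ ∧ m' = Function.update m (.addr a) (some (e.eval σ))
  | .setSlh A, σ, m, σ', m' => σ' = { σ with slh := A.eval σ m } ∧ m' = m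
  | .setSih A, σ, m, σ', m' => σ' = { σ with sih := A.eval σ m } ∧ m' = m
  | .setTmp A, σ, m, σ', m' => σ' = { σ with tmp := A.eval σ m } ∧ m' = m
  | .sghAdd A, σ, m, σ', m' => m .sgh ≠ none ∧ σ' = σ ∧
      m' = Function.update m .sgh (some (sghSet m ∪ A.eval σ m : Finset Addr))
  | .sghRem A, σ, m, σ', m' => m .sgh ≠ none ∧ σ' = σ ∧
      m' = Function.update m .sgh (some (sghSet m \ A.eval σ m : Finset Addr))
  | .setUsed, σ, m, σ', m' => m .used ≠ none ∧ σ' = σ ∧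
      m' = Function.update m .used (some true)

/-- `a` faults, that is, it accesses memory that is not allocated (or dereferences `nil`). -/
def Act.Fault : Act → Store → Mem → Prop
  | .read _ e, σ, m => ¬ ∃ a, e.eval σ = .loc a ∧ m (.addr a) ≠ none
  | .write x _, σ, m => ¬ ∃ a, σ.vars x = .loc a ∧ m (.addr a) ≠ none
  | .sghAdd _, _, m | .sghRem _, _, m => m .sgh = none
  | .setUsed, _, m => m .used = none
  | _, _, _ => False

/-- The cells that a primitive command reads. -/
def Act.reads : Act → Store → Set Loc
  | .read _ e, σ => {l | ∃ a, e.eval σ = .loc a ∧ l = .addr a}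
  | _, _ => ∅

/-- The existing cells that a primitive command overwrites. -/
def Act.writes : Act → Store → Set Loc
  | .write x _, σ => {l | ∃ a, σ.vars x = .loc a ∧ l = .addr a}
  | .sghAdd _, _ | .sghRem _, _ => {.sgh}
  | .setUsed, _ => {.used}
  | _, _ => ∅

/-- Executing a sequence of primitive commands. -/
def RunAll : List Act → Store → Mem → Store → Mem → Prop
  | [], σ, m, σ', m' => σ' = σ ∧ m' = m
  | a :: as, σ, m, σ', m' => ∃ σ₁ m₁, a.Run σ m σ₁ m₁ ∧ RunAll as σ₁ m₁ σ' m'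

def FaultAll : List Act → Store → Mem → Prop
  | [], _, _ => False
  | a :: as, σ, m => a.Fault σ m ∨ ∃ σ₁ m₁, a.Run σ m σ₁ m₁ ∧ FaultAll as σ₁ m₁

/-- Commands of the instrumented language. `ifLocal e C₁ C₂` is the ghost case distinction
"`C₁` if `e ∈ slh`, `C₂` otherwise"; `coreRun` is a running Core invocation, whose results will be
assigned to the variables `rs`. -/
inductive Cmd (K : Type u) where
  | skip
  | act (a : Act)
  | atomic (as : List Act)
  | coreAlloc (c : Var) (es : List Expr)
  | coreCall (k : ℕ) (c : Var) (es : List Expr) (rs : List Var)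
  | coreRun (q : K) (rs : List Var)
  | ifLocal (e : Expr) (C₁ C₂ : Cmd K)
  | labeled (ℓ : Label) (C : Cmd K)
  | seq (C₁ C₂ : Cmd K)
  | fork (xs : List Var) (C : Cmd K)

/-- Sequential composition of a list of commands, followed by a last one. -/
def Cmd.seqs {K : Type u} (Cs : List (Cmd K)) (C : Cmd K) : Cmd K := Cs.foldr Cmd.seq C

/-- The ghost instrumentation. -/
def instrument (K : Type u) : Stmt → Cmd K
  | .skip ℓ => .labeled ℓ .skip
  | .alloc ℓ x => .labeled ℓ <|
      .seqs [.act (.alloc x)]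
        (.act (.setSlh (.union .slh (.vals [.var x]))))
  | .read ℓ x e => .labeled ℓ <| .ifLocal e
      (.seqs [.act (.setSlh (.diff .slh (.vals [e]))), .act (.read x e)]
        (.act (.setSlh (.union .slh (.vals [e])))))
      (.atomic [.sghRem (.vals [e]), .read x e, .sghAdd (.vals [e])])
  | .write ℓ x e => .labeled ℓ <| .ifLocal (.var x)
      (.seqs [.act (.setSlh (.diff .slh (.vals [.var x]))), .act (.write x e)]
        (.act (.setSlh (.union .slh (.vals [.var x])))))
      (.atomic [.sghRem (.vals [.var x]), .setTmp (.reachSlh [e]), .setSlh (.diff .slh .tmp),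
        .write x e, .sghAdd (.union (.vals [.var x]) .tmp)])
  | .coreAlloc ℓ c es => .labeled ℓ <|
      .seqs [.atomic [.setUsed], .act (.setSlh (.diff .slh (.vals es))), .coreAlloc c es,
          .act (.setSlh (.union .slh (.vals es)))]
        (.act (.setSih (.union .sih (.vals [.var c]))))
  | .coreCall ℓ k c es rs => .labeled ℓ <|
      .seqs [.act (.setSih (.diff .sih (.vals [.var c]))), .act (.setSlh (.diff .slh (.vals es))),
          .coreCall k c es rs, .act (.setSlh (.union .slh (.vals (es ++ rs.map Expr.var))))]
        (.act (.setSih (.union .sih (.vals [.var c]))))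
  | .seq ℓ s₁ s₂ => .labeled ℓ (.seq (instrument K s₁) (instrument K s₂))
  | .fork ℓ xs s => .labeled ℓ <|
      .seqs [.act (.setTmp (.reachSlh (xs.map Expr.var))), .act (.setSlh (.diff .slh .tmp)),
          .atomic [.sghAdd .tmp]]
        (.fork xs (.seqs [.act (.setSlh .empty), .act (.setSih .empty)] (instrument K s)))

/-! ### Operational semantics -/

section Semantics

variable {K : Type u}

/-- The value of `e` is a heap location in the ghost set `slh`. -/
def IsLocal (σ : Store) (e : Expr) : Prop := ∃ a ∈ σ.slh, e.eval σ = .loc a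

/-- A thread: the command that remains to be executed, and its store. -/
abbrev Thread (K : Type u) := Cmd K × Store

/-- One step of a thread; the last argument is the thread that the step spawns, if any. A label only
marks a program point, and resolving the case distinction `ifLocal` is not a step of its own. -/
inductive Step (core : CoreImpl K) :
    Cmd K → Store → Mem → Cmd K → Store → Mem → Option (Thread K) → Prop
  | act {a σ m σ' m'} : a.Run σ m σ' m' → Step core (.act a) σ m .skip σ' m' none
  | atomic {as σ m σ' m'} : RunAll as σ m σ' m' → Step core (.atomic as) σ m .skip σ' m' none
  | coreAlloc {c es σ m} : Step core (.coreAlloc c es) σ m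
      (.coreRun (core.alloc (evals σ es)) [c]) σ m none
  | coreCall {k c es rs σ m} : Step core (.coreCall k c es rs) σ m
      (.coreRun (core.call k (σ.vars c) (evals σ es)) rs) σ m none
  | coreStep {q rs σ m q' m' t} : core.step q m q' m' t →
      Step core (.coreRun q rs) σ m (.coreRun q' rs) σ m'
        (t.map (fun q₀ => (.coreRun q₀ [], Store.init)))
  | coreReturn {q rs σ m vs} : core.result q vs → vs.length = rs.length →
      Step core (.coreRun q rs) σ m .skip (σ.sets rs vs) m none
  | ifPos {e C₁ C₂ σ m C' σ' m' t} : IsLocal σ e → Step core C₁ σ m C' σ' m' t →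
      Step core (.ifLocal e C₁ C₂) σ m C' σ' m' t
  | ifNeg {e C₁ C₂ σ m C' σ' m' t} : ¬ IsLocal σ e → Step core C₂ σ m C' σ' m' t →
      Step core (.ifLocal e C₁ C₂) σ m C' σ' m' t
  | labeledSkip {ℓ σ m} : Step core (.labeled ℓ .skip) σ m .skip σ m none
  | labeled {ℓ C σ m C' σ' m' t} : Step core C σ m C' σ' m' t →
      Step core (.labeled ℓ C) σ m C' σ' m' t
  | seqSkip {C σ m} : Step core (.seq .skip C) σ m C σ m none
  | seq {C₁ C₂ σ m C₁' σ' m' t} : Step core C₁ σ m C₁' σ' m' t →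
      Step core (.seq C₁ C₂) σ m (.seq C₁' C₂) σ' m' t
  | fork {xs C σ m} : Step core (.fork xs C) σ m .skip σ m (some (C, σ.child xs))

/-- The next step of the command may fault. -/
def Cmd.Fault (core : CoreImpl K) : Cmd K → Store → Mem → Prop
  | .act a, σ, m => a.Fault σ m
  | .atomic as, σ, m => FaultAll as σ m
  | .coreRun q _, _, m => core.fault q m
  | .ifLocal e C₁ C₂, σ, m =>
      (IsLocal σ e ∧ C₁.Fault core σ m) ∨ (¬ IsLocal σ e ∧ C₂.Fault core σ m)
  | .labeled _ C, σ, m => C.Fault core σ m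
  | .seq C₁ _, σ, m => C₁.Fault core σ m
  | _, _, _ => False

/-- The cells that the next step of the command reads outside of atomic blocks. -/
def Cmd.reads (core : CoreImpl K) : Cmd K → Store → Set Loc
  | .act a, σ => a.reads σ
  | .coreRun q _, _ => core.reads q
  | .ifLocal e C₁ C₂, σ =>
      {l | (IsLocal σ e ∧ l ∈ C₁.reads core σ) ∨ (¬ IsLocal σ e ∧ l ∈ C₂.reads core σ)}
  | .labeled _ C, σ => C.reads core σ
  | .seq C₁ _, σ => C₁.reads core σ
  | _, _ => ∅

/-- The cells that the next step of the command writes outside of atomic blocks. -/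
def Cmd.writes (core : CoreImpl K) : Cmd K → Store → Set Loc
  | .act a, σ => a.writes σ
  | .coreRun q _, _ => core.writes q
  | .ifLocal e C₁ C₂, σ =>
      {l | (IsLocal σ e ∧ l ∈ C₁.writes core σ) ∨ (¬ IsLocal σ e ∧ l ∈ C₂.writes core σ)}
  | .labeled _ C, σ => C.writes core σ
  | .seq C₁ _, σ => C₁.writes core σ
  | _, _ => ∅

/-- The program points at which a thread with this remaining command is: the labels `ℓ` such that
its next step is the first step of the statement labeled `ℓ`. -/
def Cmd.points : Cmd K → Set Label
  | .labeled ℓ C => {ℓ} ∪ C.points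
  | .seq C₁ _ => C₁.points
  | _ => ∅

/-- A configuration of the whole program: the pool of threads and the shared memory. -/
structure Config (K : Type u) where
  threads : List (Thread K)
  mem : Mem

/-- Interleaving semantics: some thread of the pool makes a step. -/
inductive PoolStep (core : CoreImpl K) : Config K → Config K → Prop
  | step {T₁ T₂ : List (Thread K)} {C σ m C' σ' m' t} : Step core C σ m C' σ' m' t →
      PoolStep core ⟨T₁ ++ (C, σ) :: T₂, m⟩ ⟨T₁ ++ (C', σ') :: T₂ ++ t.toList, m'⟩

/-- Traces: finite executions of a pool of threads. -/
abbrev Trace (core : CoreImpl K) := {τ : List (Config K) // τ.IsChain (PoolStep core)}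

/-- On some trace in `𝒯`, some thread is at the program point before the statement labeled `ℓ`,
with store `σ`, and the memory is `m`. -/
def AtPoint {core : CoreImpl K} (𝒯 : Set (Trace core)) (ℓ : Label) (σ : Store) (m : Mem) : Prop :=
  ∃ τ ∈ 𝒯, ∃ cfg ∈ τ.1, cfg.mem = m ∧ ∃ C, (C, σ) ∈ cfg.threads ∧ ℓ ∈ C.points

/-! ### Permissions and assertions -/

/-- Fractional permissions. -/
abbrev Perm := {q : ℚ // 0 < q ∧ q ≤ 1}

/-- Partial heaps with fractional permissions. -/
abbrev Heap := (l : Loc) → Option (Perm × l.Cell)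

/-- Composition of two partial cells: contents agree, permissions are added. -/
def JoinCell {α : Type} : Option (Perm × α) → Option (Perm × α) → Option (Perm × α) → Prop
  | none, y, z => z = y
  | some x, none, z => z = some x
  | some (p, v), some (q, w), z => v = w ∧ ∃ r : Perm, r.1 = p.1 + q.1 ∧ z = some (r, v)

/-- `h` is the composition of the compatible heaps `h₁` and `h₂`. -/
def Join (h₁ h₂ h : Heap) : Prop := ∀ l, JoinCell (h₁ l) (h₂ l) (h l)

/-- `h` is the composition of the heaps in the list. -/
def JoinAll : List Heap → Heap → Prop
  | [], h => h = fun _ => none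
  | h₁ :: hs, h => ∃ k, JoinAll hs k ∧ Join h₁ k h

/-- The memory as a heap, with full permission to every allocated cell. -/
def Mem.toHeap (m : Mem) : Heap := fun l => (m l).map (fun v => (⟨1, by norm_num⟩, v))

/-- The amount of permission that a heap holds to a cell. -/
def Heap.perm (h : Heap) (l : Loc) : ℚ :=
  match h l with
  | none => 0
  | some (p, _) => p.1

/-- Assertions about heaps. -/
abbrev HProp := Heap → Prop

/-- Assertions that depend on the thread's store. -/
abbrev Assn := Store → HProp

def Entails (P Q : HProp) : Prop := ∀ h, P h → Q h

/-- Separating conjunction (intuitionistic: it holds if some part of the heap splits). -/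
def star (P Q : HProp) : HProp := fun h =>
  ∃ h₁ h₂ h₃, JoinAll [h₁, h₂, h₃] h ∧ P h₁ ∧ Q h₂

def starAll (Ps : List HProp) : HProp := Ps.foldr star (fun _ => True)

/-- Iterated separating conjunction over a finite set. -/
noncomputable def bigStar (S : Finset Addr) (P : Addr → HProp) : HProp :=
  starAll (S.toList.map P)

/-- Full permission to a heap location. -/
def acc (a : Addr) : HProp := fun h => h.perm (.addr a) = 1

/-- At least permission `q` to the location that `v` points to, if `v` points to a location. -/
def accNilFrac (q : ℚ) (v : Val) : HProp := fun h => ∀ a, v = .loc a → q ≤ h.perm (.addr a)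

/-- `v ≠ nil → acc v` -/
def accNil (v : Val) : HProp := fun h => ∀ a, v = .loc a → acc a h

/-- `v ≠ nil → inv v` -/
def invNil (inv : Val → HProp) (v : Val) : HProp := fun h => v ≠ .nil → inv v h

/-- Permission `q i` to the location that the `i`-th argument points to. -/
def permArgs (q : ℕ → ℚ) (vs : List Val) : HProp :=
  starAll (vs.mapIdx (fun i v => accNilFrac (q i) v))

def accNilAll (vs : List Val) : HProp := starAll (vs.map accNil)

/-- `sgh ↦ S` with full permission. -/
def sghIs (S : Finset Addr) : HProp := fun h => h.perm .sgh = 1 ∧ ∃ p, h .sgh = some (p, S)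

/-- `used ↦ b` with full permission. -/
def usedIs (b : Bool) : HProp := fun h => h.perm .used = 1 ∧ ∃ p, h .used = some (p, b)

/-- The local program invariant. -/
noncomputable def localInv (inv : Val → HProp) : Assn := fun σ =>
  star (bigStar σ.slh acc) (bigStar σ.sih (fun i => inv (.loc i)))

/-- The global program invariant, for the I/O specification `φ`. -/
noncomputable def globalInv (φ : HProp) : HProp := fun h => ∃ (S : Finset Addr) (b : Bool),
  starAll [sghIs S, bigStar S acc, usedIs b, fun h' => b = false → φ h'] h

/-! ### Semantic triples -/

/-- On the traces `𝒯`, a thread with remaining command `C` may be in store `σ` and memory `m`: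
whenever `C` is about to start a labeled statement, this state occurs at that program point. -/
def Admissible {core : CoreImpl K} (𝒯 : Set (Trace core)) (C : Cmd K) (σ : Store) (m : Mem) :
    Prop :=
  ∀ ℓ ∈ C.points, AtPoint 𝒯 ℓ σ m

/-- Safety for `n` steps of a thread that owns the heap `h`, under the resource invariant `J`, on the
traces `𝒯`: if the thread has terminated then the postcondition holds; its next step does not fault
and accesses non-atomically only cells for which it owns permission; and after each step the
memory splits again into a heap with which the thread is safe, a heap with which a newly spawned
thread is safe, a heap that satisfies `J`, and the unchanged frame. -/
def Safe {core : CoreImpl K} (𝒯 : Set (Trace core)) (J : HProp) :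
    ℕ → Assn → Cmd K → Store → Heap → Prop
  | 0, _, _, _, _ => True
  | n + 1, Q, C, σ, h =>
    (C = .skip → Q σ h) ∧
    ∀ hJ hF m, J hJ → JoinAll [h, hJ, hF] m.toHeap → Admissible 𝒯 C σ m →
      ¬ C.Fault core σ m ∧
      (∀ l ∈ C.reads core σ, 0 < h.perm l) ∧
      (∀ l ∈ C.writes core σ, h.perm l = 1) ∧
      ∀ C' σ' m' t, Step core C σ m C' σ' m' t →
        ∃ h' hT hJ', J hJ' ∧ JoinAll [h', hT, hJ', hF] m'.toHeap ∧
          Safe 𝒯 J n Q C' σ' h' ∧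
          ∀ T ∈ t, Safe 𝒯 J n (fun _ _ => True) T.1 T.2 hT

/-- The semantic triple `J ⊨ {P} C {Q}` on the traces `𝒯`. -/
def Valid {core : CoreImpl K} (𝒯 : Set (Trace core)) (J : HProp) (P : Assn) (C : Cmd K)
    (Q : Assn) : Prop :=
  ∀ n σ h, P σ h → Safe 𝒯 J n Q C σ h

/-! ### Specification of the Core -/

/-- Specification of the Core's constructor and API functions. The preconditions are `φ ⋆ R` and
`invNil c ⋆ S_k`, where `R` and `S_k` are permissions for the arguments, of the amounts `allocPerm`
and `callPerm k`; the postconditions are `inv c ⋆ R'` and `invNil c ⋆ S'_k`, with `R' = allocPost`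
and `S'_k = callPost k`. -/
structure CoreSpec where
  allocPerm : ℕ → ℚ
  /-- from the new instance and the arguments -/
  allocPost : Val → List Val → HProp
  callPerm : ℕ → ℕ → ℚ
  /-- from the instance, the arguments and the results -/
  callPost : ℕ → Val → List Val → List Val → HProp

/-- Preconditions require at most full permission for the non-nil arguments, and postconditions
return at least these permissions, and full permission for the non-nil results. -/
structure CoreSpec.Restricted (spec : CoreSpec) : Prop where
  allocPre : ∀ es, Entails (accNilAll es) (permArgs spec.allocPerm es)
  allocPost : ∀ c es, Entails (spec.allocPost c es) (permArgs spec.allocPerm es)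
  callPre : ∀ k es, Entails (accNilAll es) (permArgs (spec.callPerm k) es)
  callPost : ∀ k c es rs, Entails (spec.callPost k c es rs)
    (star (permArgs (spec.callPerm k) es) (accNilAll rs))

/-- The Core has been verified: every Core statement in `s` satisfies its specification. -/
def CoreVerified {core : CoreImpl K} (𝒯 : Set (Trace core)) (spec : CoreSpec) (φ : HProp)
    (inv : Val → HProp) : Stmt → Prop
  | .coreAlloc _ c es => Valid 𝒯 (globalInv φ)
      (fun σ => star φ (permArgs spec.allocPerm (evals σ es)))
      (.coreAlloc c es)
      (fun σ => star (inv (σ.vars c)) (spec.allocPost (σ.vars c) (evals σ es)))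
  | .coreCall _ k c es rs => Valid 𝒯 (globalInv φ)
      (fun σ => star (invNil inv (σ.vars c)) (permArgs (spec.callPerm k) (evals σ es)))
      (.coreCall k c es rs)
      (fun σ => star (invNil inv (σ.vars c))
        (spec.callPost k (σ.vars c) (evals σ es) (rs.map σ.vars)))
  | .seq _ s₁ s₂ => CoreVerified 𝒯 spec φ inv s₁ ∧ CoreVerified 𝒯 spec φ inv s₂
  | .fork _ _ s => CoreVerified 𝒯 spec φ inv s
  | _ => True

/-! ### Side conditions and proof rules -/

/-- No two values in the list point to the same heap location. -/
def DisjointVals (vs : List Val) : Prop := vs.Pairwise (fun v w => ∀ a, v = .loc a → w ≠ .loc a)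

/-- The side condition of a statement, in a given state. -/
def SideCond : Stmt → Store → Mem → Prop
  | .read _ _ e, σ, m => ∃ a ∈ σ.slh ∪ sghSet m, e.eval σ = .loc a
  | .write _ x _, σ, m => ∃ a ∈ σ.slh ∪ sghSet m, σ.vars x = .loc a
  | .coreAlloc _ _ es, σ, m =>
      m .used = some false ∧ addrs (evals σ es) ⊆ σ.slh ∧ DisjointVals (evals σ es)
  | .coreCall _ _ c es _, σ, _ =>
      addrs (evals σ es) ⊆ σ.slh ∧ DisjointVals (evals σ es) ∧
        ((∃ a ∈ σ.sih, σ.vars c = .loc a) ∨ σ.vars c = .nil)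
  | _, _, _ => True

/-- The side condition `ω(s)`: it holds on all traces, at the program point before `s`. -/
def Omega {core : CoreImpl K} (𝒯 : Set (Trace core)) (s : Stmt) : Prop :=
  ∀ σ m, AtPoint 𝒯 s.label σ m → SideCond s σ m

/-- Derivability by the proof rules Simple, Seq and Fork. `Derivable 𝒯 s` is the judgment
`Π_g ⊢ {Π_l} 𝔸(s) {Π_l}`; all judgments of the system have this form. -/
inductive Derivable {core : CoreImpl K} (𝒯 : Set (Trace core)) : Stmt → Prop
  | simple {s} : s.IsSimple → Omega 𝒯 s → Derivable 𝒯 s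
  | seq {ℓ s₁ s₂} : Derivable 𝒯 s₁ → Derivable 𝒯 s₂ → Derivable 𝒯 (.seq ℓ s₁ s₂)
  | fork {ℓ xs s} : Derivable 𝒯 s → Derivable 𝒯 (.fork ℓ xs s)

end Semantics

end CoreApp

namespace CoreApp

/-! ### Heaps as weight functions -/

/-! A heap is encoded by its weight: the function that sends a cell and a possible content to the
permission held. Composition of heaps becomes addition (`join_iff`, `joinAll_iff`), being a part
becomes the pointwise order, and every nonnegative function below a weight is itself a weight
(`exists_weight_eq`). Hence partial compositions and remainders exist whenever the inequalities say
so, and splitting heaps is arithmetic in an ordered abelian group. Both `φ` and `inv` are arbitrary,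
possibly not upward closed, so the heaps witnessing them are kept exactly; slack always goes to the
parts that assert full permissions, which are upward closed.

Soundness is an induction on the derivation (`Derivable.safe`). A side condition becomes available
at the first step of its statement, because safety considers only states that occur on the traces at
that program point (`safe_labeled`). What it says about the thread's own store remains usable
afterwards, since no other thread changes that store.

A read or write of a location in `slh` is covered by owned permission. Otherwise the location lies
in `sgh`, and an atomic block may use the permission inside the global invariant. A shared write and
a fork move an escaping set `D ⊆ slh` into the invariant (`share`); nothing about reachability
matters beyond this inclusion. A forked thread starts with empty ghost sets, so its local invariant
holds on the empty heap.

For the constructor of the Core, `used = false` means that the invariant contains `φ`; setting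
`used` makes the implication vacuous and releases `φ` to the thread. For any Core invocation, full
permission to pairwise distinct arguments splits into the required fractions and a remainder. The
remainder is framed, and full permission is recovered on return (`exists_permArgs_split`,
`safe_lend`). Single assignment keeps the arguments' values unchanged when results are assigned. -/

open Classical in
/-- A partial cell as a finitely supported function: the permission held to each possible content. -/
noncomputable def cellWeight {α : Type} : Option (Perm × α) → α → ℚ
  | none => 0
  | some (p, v) => Pi.single v p.1

/-- The permission of a partial cell. -/
def cellPerm {α : Type} : Option (Perm × α) → ℚ
  | none => 0
  | some (p, _) => p.1

theorem cellWeight_nonneg {α : Type} (x : Option (Perm × α)) : 0 ≤ cellWeight x := by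
  classical
  rcases x with _ | ⟨p, v⟩
  · exact le_rfl
  · exact Pi.single_nonneg.2 p.2.1.le

/-- A nonnegative function below a point mass is concentrated at the same point. Its value there is
either zero, which is the absent cell, or a legitimate permission. -/
theorem exists_cellWeight_eq {α : Type} {f : α → ℚ} {x : Option (Perm × α)} (h0 : 0 ≤ f)
    (hf : f ≤ cellWeight x) : ∃ y, cellWeight y = f := by
  classical
  rcases x with _ | ⟨p, v⟩
  · exact ⟨none, le_antisymm h0 hf⟩
  · have hne : ∀ w, w ≠ v → f w = 0 := fun w hw =>
      le_antisymm (by simpa [cellWeight, hw] using hf w) (h0 w)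
    have hv : f v ≤ p.1 := by simpa [cellWeight] using hf v
    have hs : f = Pi.single v (f v) := by
      ext w
      by_cases hw : w = v
      · subst hw; simp
      · simp [hw, hne w hw]
    rcases (h0 v).eq_or_lt with h | h
    · refine ⟨none, ?_⟩
      rw [hs, ← h]
      simp [cellWeight]
    · refine ⟨some (⟨f v, h, hv.trans p.2.2⟩, v), ?_⟩
      simp only [cellWeight]
      convert hs.symm

theorem cellWeight_single_ne {α : Type} {p : Perm} {v : α} :
    cellWeight (some (p, v)) v ≠ 0 := by
  simpa [cellWeight] using p.2.1.ne'

/-- Two nonzero point masses add up to a point mass only if they sit at the same point; this encodes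
agreement of contents. The bound 1 on the sum is carried by the permission in `z`. -/
theorem joinCell_iff {α : Type} (x y z : Option (Perm × α)) :
    JoinCell x y z ↔ cellWeight x + cellWeight y = cellWeight z := by
  classical
  have key : ∀ (x y : Option (Perm × α)), cellWeight x = cellWeight y → x = y := by
    intro x y h
    rcases x with _ | ⟨p, v⟩ <;> rcases y with _ | ⟨q, w⟩
    · rfl
    · exact absurd (congrFun h.symm w) cellWeight_single_ne
    · exact absurd (congrFun h v) cellWeight_single_ne
    · have hvw : v = w := by
        by_contra hne
        have := congrFun h v
        rw [show cellWeight (some (q, w)) v = 0 by simp [cellWeight, hne]] at this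
        exact cellWeight_single_ne this
      subst hvw
      have := congrFun h v
      simp only [cellWeight, Pi.single_eq_same] at this
      rw [Subtype.ext this]
  rcases x with _ | ⟨p, v⟩
  · simp only [JoinCell, cellWeight, zero_add]
    exact ⟨fun h => by rw [h], fun h => (key _ _ h).symm⟩
  rcases y with _ | ⟨q, w⟩
  · simp only [JoinCell]
    rw [show cellWeight (none : Option (Perm × α)) = 0 from rfl, add_zero]
    exact ⟨fun h => by rw [h], fun h => (key _ _ h).symm⟩
  constructor
  · rintro ⟨rfl, r, hr, rfl⟩
    simp [cellWeight, hr, Pi.single_add]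
  · intro h
    rcases z with _ | ⟨r, u⟩
    · have hv := congrFun h v
      have h1 := cellWeight_nonneg (some (q, w)) v
      have h2 := p.2.1
      simp only [cellWeight, Pi.add_apply, Pi.single_eq_same, Pi.zero_apply] at hv h1
      linarith
    · have hu : ∀ w', w' ≠ u → cellWeight (some (p, v)) w' = 0 ∧ cellWeight (some (q, w)) w' = 0 := by
        intro w' hw'
        have h0 := congrFun h w'
        have h1 := cellWeight_nonneg (some (p, v)) w'
        have h2 := cellWeight_nonneg (some (q, w)) w'
        rw [show cellWeight (some (r, u)) w' = 0 by simp [cellWeight, hw']] at h0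
        simp only [Pi.add_apply, Pi.zero_apply] at h0 h1 h2
        constructor <;> linarith
      have hv : v = u := by
        by_contra hne
        exact cellWeight_single_ne (hu v hne).1
      have hw : w = u := by
        by_contra hne
        exact cellWeight_single_ne (hu w hne).2
      subst hv hw
      have := congrFun h w
      simp only [cellWeight, Pi.add_apply, Pi.single_eq_same] at this
      exact ⟨rfl, r, this.symm, rfl⟩

theorem cellPerm_add {α : Type} {x y z : Option (Perm × α)}
    (h : cellWeight x + cellWeight y = cellWeight z) : cellPerm z = cellPerm x + cellPerm y := by
  have h := (joinCell_iff x y z).2 h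
  rcases x with _ | ⟨p, v⟩ <;> rcases y with _ | ⟨q, w⟩
  · cases h; simp [cellPerm]
  · cases h; simp [cellPerm]
  · cases h; simp [cellPerm]
  · obtain ⟨rfl, r, hr, rfl⟩ := h
    exact hr

/-- A heap as a function: the permission held to each possible content of each cell. -/
noncomputable def Heap.weight (h : Heap) : (l : Loc) → l.Cell → ℚ := fun l => cellWeight (h l)

/-- The heap without any permission. -/
def Heap.empty : Heap := fun _ => none

theorem Heap.weight_empty : Heap.empty.weight = 0 := rfl

theorem Heap.weight_nonneg (h : Heap) : 0 ≤ h.weight := fun l => cellWeight_nonneg (h l)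

theorem Heap.perm_eq (h : Heap) (l : Loc) : h.perm l = cellPerm (h l) := by
  unfold Heap.perm cellPerm
  rcases h l with _ | ⟨p, v⟩ <;> rfl

/-- This replaces all compatibility checks: a sum or difference of weights comes from a heap once it
is nonnegative and bounded by a weight. -/
theorem exists_weight_eq {f : (l : Loc) → l.Cell → ℚ} {h : Heap} (h0 : 0 ≤ f)
    (hf : f ≤ h.weight) : ∃ k : Heap, k.weight = f := by
  choose k hk using fun l => exists_cellWeight_eq (h0 l) (hf l)
  exact ⟨k, funext hk⟩

theorem join_iff {h₁ h₂ h : Heap} : Join h₁ h₂ h ↔ h₁.weight + h₂.weight = h.weight := by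
  simp only [Join, joinCell_iff, funext_iff (f := h₁.weight + h₂.weight)]
  rfl

theorem weight_eq_zero {h : Heap} : h.weight = 0 ↔ h = Heap.empty := by
  constructor
  · intro h0
    funext l
    rcases hl : h l with _ | ⟨p, v⟩
    · rfl
    · have := congrFun (congrFun h0 l) v
      rw [Heap.weight, hl] at this
      exact absurd this cellWeight_single_ne
  · rintro rfl; rfl

theorem sum_weight_nonneg (hs : List Heap) : 0 ≤ (hs.map Heap.weight).sum :=
  List.sum_nonneg (by simpa using fun h _ => h.weight_nonneg)

theorem joinAll_iff {hs : List Heap} {h : Heap} :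
    JoinAll hs h ↔ (hs.map Heap.weight).sum = h.weight := by
  induction hs generalizing h with
  | nil =>
    simp only [JoinAll, List.map_nil, List.sum_nil]
    exact weight_eq_zero.symm.trans eq_comm
  | cons h₁ hs ih =>
    simp only [JoinAll, List.map_cons, List.sum_cons, join_iff, ih]
    constructor
    · rintro ⟨k, hk, h⟩
      rw [hk, h]
    · intro h'
      obtain ⟨k, hk⟩ := exists_weight_eq (h := h) (sum_weight_nonneg hs)
        (h' ▸ le_add_of_nonneg_left h₁.weight_nonneg)
      exact ⟨k, hk.symm, by rw [hk, h']⟩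

theorem joinAll_three {h₁ h₂ h₃ h : Heap} :
    JoinAll [h₁, h₂, h₃] h ↔ h₁.weight + h₂.weight + h₃.weight = h.weight := by
  rw [joinAll_iff]; simp [add_assoc]

theorem joinAll_four {h₁ h₂ h₃ h₄ h : Heap} :
    JoinAll [h₁, h₂, h₃, h₄] h ↔
      h₁.weight + h₂.weight + h₃.weight + h₄.weight = h.weight := by
  rw [joinAll_iff]; simp [add_assoc]

theorem exists_add_of_le {k h : Heap} (hk : k.weight ≤ h.weight) :
    ∃ r : Heap, k.weight + r.weight = h.weight := by
  obtain ⟨r, hr⟩ := exists_weight_eq (f := h.weight - k.weight) (h := h) (sub_nonneg.2 hk)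
    (sub_le_self _ k.weight_nonneg)
  exact ⟨r, by rw [hr]; abel⟩

theorem exists_add_eq {h₁ h₂ h : Heap} (hle : h₁.weight + h₂.weight ≤ h.weight) :
    ∃ k : Heap, k.weight = h₁.weight + h₂.weight :=
  exists_weight_eq (add_nonneg h₁.weight_nonneg h₂.weight_nonneg) hle

/-! ### Permission amounts and cells held with full permission. -/

theorem perm_nonneg (h : Heap) (l : Loc) : 0 ≤ h.perm l := by
  rw [Heap.perm_eq]
  rcases h l with _ | ⟨p, v⟩
  · exact le_rfl
  · exact p.2.1.le

theorem perm_le_one (h : Heap) (l : Loc) : h.perm l ≤ 1 := by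
  rw [Heap.perm_eq]
  rcases h l with _ | ⟨p, v⟩
  · exact zero_le_one
  · exact p.2.2

theorem perm_add {h₁ h₂ h : Heap} (hw : h₁.weight + h₂.weight = h.weight) (l : Loc) :
    h.perm l = h₁.perm l + h₂.perm l := by
  simp only [Heap.perm_eq]
  exact cellPerm_add (congrFun hw l)

theorem perm_mono {k h : Heap} (hk : k.weight ≤ h.weight) (l : Loc) : k.perm l ≤ h.perm l := by
  obtain ⟨r, hr⟩ := exists_add_of_le hk
  rw [perm_add hr]
  exact le_add_of_nonneg_right (perm_nonneg r l)

theorem perm_add_le {h₁ h₂ h : Heap} (hw : h₁.weight + h₂.weight ≤ h.weight) (l : Loc) :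
    h₁.perm l + h₂.perm l ≤ h.perm l := by
  obtain ⟨k, hk⟩ := exists_add_eq hw
  rw [← perm_add hk.symm]
  exact perm_mono (hk ▸ hw) l

theorem eq_none_of_perm {h : Heap} {l : Loc} (hl : h.perm l = 0) : h l = none := by
  rw [Heap.perm_eq] at hl
  rcases hc : h l with _ | ⟨p, v⟩ <;> rw [hc] at hl
  exact absurd hl p.2.1.ne'

theorem eq_some_of_perm {h : Heap} {l : Loc} (hl : h.perm l = 1) :
    ∃ v, h l = some (⟨1, by norm_num⟩, v) := by
  rw [Heap.perm_eq] at hl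
  rcases hc : h l with _ | ⟨p, v⟩ <;> rw [hc] at hl
  · exact absurd hl zero_ne_one
  · exact ⟨v, by rw [show p = ⟨1, by norm_num⟩ from Subtype.ext hl]⟩

theorem perm_of_eq_some {h : Heap} {l : Loc} {p : Perm} {v : l.Cell} (hl : h l = some (p, v)) :
    h.perm l = p.1 := by
  rw [Heap.perm_eq, hl]; rfl

/-- Full permission in the part leaves none for the remainder, so the larger heap has the identical
cell. -/
theorem eq_some_of_le {k h : Heap} (hk : k.weight ≤ h.weight) {l : Loc} {v : l.Cell}
    (hl : k l = some (⟨1, by norm_num⟩, v)) : h l = some (⟨1, by norm_num⟩, v) := by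
  obtain ⟨r, hr⟩ := exists_add_of_le hk
  have hp := perm_add hr l
  have hr0 : r l = none := by
    refine eq_none_of_perm (le_antisymm ?_ (perm_nonneg _ _))
    have h1 := perm_le_one h l
    rw [perm_of_eq_some hl] at hp
    simp only at hp
    linarith
  have hj := join_iff.2 hr l
  rw [hl, hr0] at hj
  exact hj

theorem mem_of_toHeap_eq_some {m : Mem} {l : Loc} {p : Perm} {v : l.Cell}
    (h : m.toHeap l = some (p, v)) : m l = some v := by
  rw [Mem.toHeap, Option.map_eq_some_iff] at h
  obtain ⟨w, hw, he⟩ := h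
  rw [hw, (Prod.mk.inj he).2]

/-- A heap splits into its restrictions to a set of cells and to the complement. -/
theorem exists_restrict (A : Set Loc) (h : Heap) : ∃ k₁ k₂ : Heap,
    k₁.weight + k₂.weight = h.weight ∧ (∀ l ∈ A, k₁ l = h l ∧ k₂ l = none) ∧
      ∀ l ∉ A, k₁ l = none ∧ k₂ l = h l := by
  classical
  refine ⟨fun l => if l ∈ A then h l else none, fun l => if l ∈ A then none else h l, ?_, ?_, ?_⟩
  · funext l
    simp only [Heap.weight, Pi.add_apply]
    split_ifs <;> simp [cellWeight]
  · intro l hl; simp [hl]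
  · intro l hl; simp [hl]

/-- Any part of the permission to a single cell can be split off. -/
theorem exists_carve {h : Heap} {l : Loc} {w : ℚ} (h0 : 0 ≤ w) (hw : w ≤ h.perm l) :
    ∃ k₁ k₂ : Heap, k₁.weight + k₂.weight = h.weight ∧ k₁.perm l = w ∧
      ∀ l', l' ≠ l → k₁.perm l' = 0 := by
  classical
  have hc : ∃ x : Option (Perm × l.Cell), cellWeight x ≤ h.weight l ∧ cellPerm x = w := by
    rcases h0.eq_or_lt with h0 | h0
    · exact ⟨none, h.weight_nonneg l, h0⟩
    · rw [Heap.perm_eq] at hw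
      rw [Heap.weight]
      rcases hl : h l with _ | ⟨p, v⟩
      · rw [hl] at hw
        exact absurd hw (not_le.2 h0)
      · rw [hl] at hw
        refine ⟨some (⟨w, h0, hw.trans p.2.2⟩, v), ?_, rfl⟩
        simp only [cellWeight]
        exact Pi.single_mono v hw
  obtain ⟨x, hx, hxw⟩ := hc
  let k : Heap := Function.update Heap.empty l x
  have hk : k.weight ≤ h.weight := by
    intro l'
    by_cases hl : l' = l
    · subst hl
      simpa [k, Heap.weight] using hx
    · simpa [k, Heap.weight, hl, Heap.empty, cellWeight] using h.weight_nonneg l'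
  obtain ⟨r, hr⟩ := exists_add_of_le hk
  refine ⟨k, r, hr, ?_, ?_⟩
  · rw [Heap.perm_eq]; simp [k, hxw]
  · intro l' hl
    rw [Heap.perm_eq]; simp [k, hl, Heap.empty, cellPerm]

/-- Overwriting an owned cell. -/
theorem weight_update {k : Heap} {f : (l : Loc) → l.Cell → ℚ} {m : Mem}
    (hw : k.weight + f = m.toHeap.weight) (hf : 0 ≤ f)
    {l : Loc} (hl : k.perm l = 1 ∨ m l = none) (v : l.Cell) :
    Heap.weight (Function.update k l (some (⟨1, by norm_num⟩, v))) + f =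
      (Mem.toHeap (Function.update m l (some v))).weight := by
  obtain ⟨r, rfl⟩ := exists_weight_eq hf (hw ▸ le_add_of_nonneg_left k.weight_nonneg)
  -- The rest holds nothing at `l`, either because `k` exhausts the permission or because the cell
  -- is unallocated. The second case makes the lemma serve allocation too.
  have hr : r l = none := by
    refine eq_none_of_perm (le_antisymm ?_ (perm_nonneg _ _))
    have h2 := perm_add hw l
    have h3 := perm_nonneg k l
    have h4 := perm_le_one m.toHeap l
    rcases hl with hl | hl
    · linarith
    · rw [Heap.perm_eq, Mem.toHeap, hl] at h2
      simp only [Option.map_none, cellPerm] at h2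
      linarith
  funext l'
  by_cases h : l' = l
  · subst h
    simp [Heap.weight, Mem.toHeap, hr, cellWeight]
  · simpa [Heap.weight, Mem.toHeap, h] using congrFun hw l'

/-! ### Assertions -/

/-- The discarded third heap of the intuitionistic conjunction is absorbed by the inequality. -/
theorem star_iff {P Q : HProp} {h : Heap} :
    star P Q h ↔ ∃ h₁ h₂ : Heap, P h₁ ∧ Q h₂ ∧ h₁.weight + h₂.weight ≤ h.weight := by
  simp only [star, joinAll_three]
  constructor
  · rintro ⟨h₁, h₂, h₃, hw, hP, hQ⟩
    exact ⟨h₁, h₂, hP, hQ, hw ▸ le_add_of_nonneg_right h₃.weight_nonneg⟩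
  · rintro ⟨h₁, h₂, hP, hQ, hw⟩
    obtain ⟨k, hk⟩ := exists_add_eq hw
    obtain ⟨r, hr⟩ := exists_add_of_le (hk ▸ hw)
    exact ⟨h₁, h₂, r, by rw [← hk, hr], hP, hQ⟩

theorem star_mono {P Q : HProp} {h k : Heap} (hs : star P Q h) (hk : h.weight ≤ k.weight) :
    star P Q k := by
  rw [star_iff] at hs ⊢
  obtain ⟨h₁, h₂, hP, hQ, hw⟩ := hs
  exact ⟨h₁, h₂, hP, hQ, hw.trans hk⟩

/-! ### Iterated separating conjunctions, with the witnessing heaps indexed by addresses. -/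

theorem starAll_map_iff {l : List Addr} (hl : l.Nodup) {P : Addr → HProp} {h : Heap} :
    starAll (l.map P) h ↔ ∃ f : Addr → Heap, (∀ a ∈ l, P a (f a)) ∧
      (l.map fun a => (f a).weight).sum ≤ h.weight := by
  classical
  induction l generalizing h with
  | nil => simp [starAll, h.weight_nonneg]
  | cons a l ih =>
    obtain ⟨ha, hl⟩ := List.nodup_cons.1 hl
    change star (P a) (starAll (l.map P)) h ↔ _
    rw [star_iff]
    constructor
    · rintro ⟨h₁, h₂, hP, hs, hw⟩
      obtain ⟨f, hf, hfw⟩ := (ih hl).1 hs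
      have hne : ∀ b ∈ l, Function.update f a h₁ b = f b := fun b hb =>
        Function.update_of_ne (by rintro rfl; exact ha hb) _ _
      refine ⟨Function.update f a h₁, ?_, ?_⟩
      · simp only [List.mem_cons, forall_eq_or_imp, Function.update_self]
        exact ⟨hP, fun b hb => (hne b hb).symm ▸ hf b hb⟩
      · rw [List.map_cons, List.sum_cons, Function.update_self,
          List.map_congr_left (fun b hb => by rw [hne b hb])]
        exact (add_le_add_right hfw _).trans hw
    · rintro ⟨f, hf, hfw⟩
      rw [List.map_cons, List.sum_cons] at hfw
      have h0 : 0 ≤ (l.map fun a => (f a).weight).sum :=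
        List.sum_nonneg (by simpa using fun b _ => (f b).weight_nonneg)
      obtain ⟨k, hk⟩ := exists_weight_eq h0
        ((le_add_of_nonneg_left (f a).weight_nonneg).trans hfw)
      exact ⟨f a, k, hf a (by simp), (ih hl).2 ⟨f, fun b hb => hf b (by simp [hb]), hk.ge⟩,
        by rw [hk]; exact hfw⟩

theorem bigStar_iff {S : Finset Addr} {P : Addr → HProp} {h : Heap} :
    bigStar S P h ↔ ∃ f : Addr → Heap, (∀ a ∈ S, P a (f a)) ∧
      ∑ a ∈ S, (f a).weight ≤ h.weight := by
  rw [bigStar, starAll_map_iff S.nodup_toList]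
  simp [Finset.sum_map_toList]

theorem bigStar_mono {S T : Finset Addr} {P : Addr → HProp} {h k : Heap} (hs : bigStar S P h)
    (hT : T ⊆ S) (hk : h.weight ≤ k.weight) : bigStar T P k := by
  rw [bigStar_iff] at hs ⊢
  obtain ⟨f, hf, hw⟩ := hs
  exact ⟨f, fun a ha => hf a (hT ha), (Finset.sum_le_sum_of_subset_of_nonneg hT
    fun a _ _ => (f a).weight_nonneg).trans (hw.trans hk)⟩

/-- Since `P` need not be upward closed, the heap split off is exactly the witness for `a`; all
slack stays with the remaining conjunction. -/
theorem bigStar_remove {S : Finset Addr} {P : Addr → HProp} {h : Heap} (hs : bigStar S P h)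
    {a : Addr} (ha : a ∈ S) :
    ∃ h₁ h₂ : Heap, P a h₁ ∧ bigStar (S \ {a}) P h₂ ∧ h₁.weight + h₂.weight = h.weight := by
  obtain ⟨f, hf, hw⟩ := bigStar_iff.1 hs
  rw [← Finset.sum_sdiff (Finset.singleton_subset_iff.2 ha), Finset.sum_singleton, add_comm] at hw
  have h0 : 0 ≤ ∑ b ∈ S \ {a}, (f b).weight := Finset.sum_nonneg fun b _ => (f b).weight_nonneg
  obtain ⟨r, hr⟩ := exists_add_of_le ((le_add_of_nonneg_right h0).trans hw)
  refine ⟨f a, r, hf a ha, bigStar_iff.2 ⟨f, fun b hb => hf b (Finset.mem_sdiff.1 hb).1, ?_⟩, hr⟩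
  rw [← hr] at hw
  exact le_of_add_le_add_left hw

theorem bigStar_insert {S : Finset Addr} {P : Addr → HProp} {h h₁ h₂ : Heap} {a : Addr}
    (h₁P : P a h₁) (hs : bigStar S P h₂) (hw : h₁.weight + h₂.weight ≤ h.weight) :
    bigStar (S ∪ {a}) P h := by
  classical
  -- If `a` is already present, the new heap is simply dropped.
  by_cases ha : a ∈ S
  · rw [Finset.union_eq_left.2 (Finset.singleton_subset_iff.2 ha)]
    exact bigStar_mono hs subset_rfl ((le_add_of_nonneg_left h₁.weight_nonneg).trans hw)
  · obtain ⟨f, hf, hfw⟩ := bigStar_iff.1 hs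
    have hne : ∀ b ∈ S, Function.update f a h₁ b = f b := fun b hb =>
      Function.update_of_ne (by rintro rfl; exact ha hb) _ _
    refine bigStar_iff.2 ⟨Function.update f a h₁, ?_, ?_⟩
    · intro b hb
      rcases Finset.mem_union.1 hb with hb | hb
      · exact (hne b hb).symm ▸ hf b hb
      · rw [Finset.mem_singleton.1 hb, Function.update_self]
        exact h₁P
    · rw [Finset.sum_union (Finset.disjoint_singleton_right.2 ha), Finset.sum_singleton,
        Function.update_self, Finset.sum_congr rfl (fun b hb => by rw [hne b hb]), add_comm]
      exact (add_le_add_right hfw _).trans hw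

/-- Full permission to all locations in a set. -/
def Owns (S : Finset Addr) (h : Heap) : Prop := ∀ a ∈ S, h.perm (.addr a) = 1

theorem perm_eq_one_of_le {k h : Heap} (hk : k.weight ≤ h.weight) {l : Loc} (hl : k.perm l = 1) :
    h.perm l = 1 :=
  le_antisymm (perm_le_one _ _) (hl ▸ perm_mono hk l)

theorem Owns.mono {S T : Finset Addr} {h k : Heap} (hs : Owns S h) (hT : T ⊆ S)
    (hk : h.weight ≤ k.weight) : Owns T k :=
  fun a ha => perm_eq_one_of_le hk (hs a (hT ha))

theorem Owns.split {S : Finset Addr} {h : Heap} (hs : Owns S h) (T : Finset Addr) :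
    ∃ k₁ k₂ : Heap, k₁.weight + k₂.weight = h.weight ∧ Owns (S ∩ T) k₁ ∧ Owns (S \ T) k₂ := by
  obtain ⟨k₁, k₂, hw, hA, hB⟩ := exists_restrict {l | ∃ a ∈ T, l = .addr a} h
  refine ⟨k₁, k₂, hw, ?_, ?_⟩
  · intro a ha
    obtain ⟨ha, hT⟩ := Finset.mem_inter.1 ha
    rw [Heap.perm_eq, (hA _ ⟨a, hT, rfl⟩).1, ← Heap.perm_eq, hs a ha]
  · intro a ha
    obtain ⟨ha, hT⟩ := Finset.mem_sdiff.1 ha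
    have : Loc.addr a ∉ {l | ∃ a ∈ T, l = Loc.addr a} := by
      rintro ⟨b, hb, h⟩
      cases h
      exact hT hb
    rw [Heap.perm_eq, (hB _ this).2, ← Heap.perm_eq, hs a ha]

/-- Full permissions to different cells never compete, so the separating conjunction collapses to a
pointwise condition. -/
theorem bigStar_acc_iff {S : Finset Addr} {h : Heap} : bigStar S acc h ↔ Owns S h := by
  classical
  constructor
  · intro hs a ha
    obtain ⟨f, hf, hw⟩ := bigStar_iff.1 hs
    exact perm_eq_one_of_le ((Finset.single_le_sum (f := fun a => (f a).weight)
      (fun b _ => (f b).weight_nonneg) ha).trans hw) (hf a ha)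
  · induction S using Finset.induction_on generalizing h with
    | empty => exact fun _ => bigStar_iff.2 ⟨fun _ => h, by simp, by simpa using h.weight_nonneg⟩
    | insert a S ha ih =>
      intro hs
      obtain ⟨k₁, k₂, hw, h1, h2⟩ := hs.split {a}
      rw [Finset.insert_eq, Finset.union_comm]
      refine bigStar_insert (h1 a (by simp)) (ih (h2.mono ?_ le_rfl)) hw.le
      intro b hb
      simp only [Finset.mem_sdiff, Finset.mem_insert, Finset.mem_singleton]
      exact ⟨.inr hb, fun h => ha (h ▸ hb)⟩

theorem localInv_iff {inv : Val → HProp} {σ : Store} {h : Heap} :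
    localInv inv σ h ↔ ∃ h₁ h₂ : Heap, Owns σ.slh h₁ ∧
      bigStar σ.sih (fun i => inv (.loc i)) h₂ ∧ h₁.weight + h₂.weight ≤ h.weight := by
  rw [localInv, star_iff]
  simp only [bigStar_acc_iff]

/-- The part of the global invariant that does not depend on the I/O specification. -/
structure OwnsShared (S : Finset Addr) (b : Bool) (h : Heap) : Prop where
  sgh : h .sgh = some (⟨1, by norm_num⟩, S)
  used : h .used = some (⟨1, by norm_num⟩, b)
  owns : Owns S h

/-- The heap for `φ` is kept exactly, and everything else, including slack, joins the first part,
whose conditions are upward closed. This is why an equation can replace the inequality. -/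
theorem globalInv_iff {φ : HProp} {h : Heap} :
    globalInv φ h ↔ ∃ S b, ∃ h₁ h₂ : Heap, OwnsShared S b h₁ ∧ (b = false → φ h₂) ∧
      h₁.weight + h₂.weight = h.weight := by
  have hsgh : ∀ {S k}, sghIs S k ↔ k .sgh = some (⟨1, by norm_num⟩, S) := by
    intro S k
    constructor
    · rintro ⟨hk, p, hp⟩
      have : p = ⟨1, by norm_num⟩ := Subtype.ext ((perm_of_eq_some hp).symm.trans hk)
      rw [hp, this]
    · intro hk
      exact ⟨perm_of_eq_some hk, _, hk⟩
  have hused : ∀ {b k}, usedIs b k ↔ k .used = some (⟨1, by norm_num⟩, b) := by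
    intro b k
    constructor
    · rintro ⟨hk, p, hp⟩
      have : p = ⟨1, by norm_num⟩ := Subtype.ext ((perm_of_eq_some hp).symm.trans hk)
      rw [hp, this]
    · intro hk
      exact ⟨perm_of_eq_some hk, _, hk⟩
  simp only [globalInv, starAll, List.foldr, star_iff, bigStar_acc_iff]
  refine exists_congr fun S => exists_congr fun b => ?_
  constructor
  · rintro ⟨h₁, k₁, hS, ⟨h₂, k₂, hO, ⟨h₃, k₃, hU, ⟨h₄, k₄, hφ, -, w₄⟩, w₃⟩, w₂⟩, w₁⟩
    have hle : h₁.weight + h₂.weight + h₃.weight + h₄.weight ≤ h.weight := by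
      have h0 := k₄.weight_nonneg
      intro l v
      have := w₁ l v; have := w₂ l v; have := w₃ l v; have := w₄ l v; have := h0 l v
      simp only [Pi.add_apply, Pi.zero_apply] at *
      linarith
    have h4 : h₄.weight ≤ h.weight := (le_add_of_nonneg_left (add_nonneg (add_nonneg
      h₁.weight_nonneg h₂.weight_nonneg) h₃.weight_nonneg)).trans hle
    obtain ⟨r, hr⟩ := exists_add_of_le h4
    have hr' : h₁.weight + h₂.weight + h₃.weight ≤ r.weight := by
      rw [← hr, add_comm] at hle
      exact le_of_add_le_add_left hle
    have i1 := h₁.weight_nonneg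
    have i2 := h₂.weight_nonneg
    have i3 := h₃.weight_nonneg
    refine ⟨r, h₄, ⟨?_, ?_, ?_⟩, hφ, by rw [add_comm, hr]⟩
    · exact eq_some_of_le ((le_add_of_nonneg_right i2).trans
        ((le_add_of_nonneg_right i3).trans hr')) (hsgh.1 hS)
    · exact eq_some_of_le ((le_add_of_nonneg_left (add_nonneg i1 i2)).trans hr') (hused.1 hU)
    · exact hO.mono subset_rfl ((le_add_of_nonneg_left i1).trans
        ((le_add_of_nonneg_right i3).trans hr'))
  · rintro ⟨h₁, h₂, ⟨hS, hU, hO⟩, hφ, hw⟩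
    obtain ⟨a₁, b₁, w₁, hA₁, hB₁⟩ := exists_restrict {Loc.sgh} h₁
    obtain ⟨a₂, b₂, w₂, hA₂, hB₂⟩ := exists_restrict {Loc.used} b₁
    have hle : b₁.weight + h₂.weight ≤ h.weight := by
      rw [← hw, ← w₁]
      exact add_le_add_left (le_add_of_nonneg_left a₁.weight_nonneg) _
    obtain ⟨c₁, hc₁⟩ := exists_add_eq hle
    have hle' : a₂.weight + h₂.weight ≤ h.weight :=
      (add_le_add_left (w₂ ▸ le_add_of_nonneg_right b₂.weight_nonneg) _).trans hle
    obtain ⟨c₂, hc₂⟩ := exists_add_eq hle'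
    refine ⟨a₁, c₁, hsgh.2 ((hA₁ _ rfl).1.trans hS), ⟨b₂, c₂, ?_, ⟨a₂, h₂, ?_, ⟨h₂, Heap.empty, hφ,
      trivial, ?_⟩, ?_⟩, ?_⟩, ?_⟩
    · intro a ha
      rw [Heap.perm_eq, (hB₂ _ (by simp)).2, (hB₁ _ (by simp)).2, ← Heap.perm_eq, hO a ha]
    · exact hused.2 ((hA₂ _ rfl).1.trans ((hB₁ _ (by simp)).2.trans hU))
    · rw [Heap.weight_empty, add_zero]
    · exact hc₂.ge
    · rw [hc₂, hc₁, ← w₂]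
      exact le_of_eq (by abel)
    · rw [hc₁, ← hw, ← w₁]
      exact le_of_eq (by abel)

/-! ### Permissions for arguments -/

theorem mem_addrs {vs : List Val} {a : Addr} : a ∈ addrs vs ↔ Val.loc a ∈ vs := by
  simp only [addrs, List.mem_toFinset, List.mem_filterMap]
  constructor
  · rintro ⟨v, hv, h⟩
    rcases v with _ | _ | b <;> simp [Val.addr?] at h
    exact h ▸ hv
  · exact fun h => ⟨_, h, rfl⟩

theorem permArgs_cons (q : ℕ → ℚ) (v : Val) (vs : List Val) :
    permArgs q (v :: vs) = star (accNilFrac (q 0) v) (permArgs (fun i => q (i + 1)) vs) := by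
  simp [permArgs, starAll, List.mapIdx_cons]

theorem accNilAll_cons (v : Val) (vs : List Val) :
    accNilAll (v :: vs) = star (accNil v) (accNilAll vs) := rfl

theorem accNilAll_owns {vs : List Val} {h : Heap} (hs : accNilAll vs h) : Owns (addrs vs) h := by
  induction vs generalizing h with
  | nil => intro a ha; simp [addrs] at ha
  | cons v vs ih =>
    rw [accNilAll_cons, star_iff] at hs
    obtain ⟨h₁, h₂, h1, h2, hw⟩ := hs
    intro a ha
    rcases List.mem_cons.1 (mem_addrs.1 ha) with h | h
    · exact perm_eq_one_of_le ((le_add_of_nonneg_right h₂.weight_nonneg).trans hw) (h1 a h.symm)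
    · exact perm_eq_one_of_le ((le_add_of_nonneg_left h₁.weight_nonneg).trans hw)
        (ih h2 a (mem_addrs.2 h))

theorem disjointVals_cons {v : Val} {vs : List Val} (hd : DisjointVals (v :: vs)) :
    (∀ a, v = .loc a → a ∉ addrs vs) ∧ DisjointVals vs := by
  obtain ⟨h1, h2⟩ := List.pairwise_cons.1 hd
  exact ⟨fun a ha hm => h1 _ (mem_addrs.1 hm) a ha rfl, h2⟩

/-- Distinctness is essential: a repeated pointer would demand full permission to one cell twice. -/
theorem accNilAll_of_owns {vs : List Val} (hd : DisjointVals vs) {h : Heap}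
    (ho : Owns (addrs vs) h) : accNilAll vs h := by
  induction vs generalizing h with
  | nil => trivial
  | cons v vs ih =>
    obtain ⟨hv, hd⟩ := disjointVals_cons hd
    rw [accNilAll_cons, star_iff]
    obtain ⟨k₁, k₂, hw, h1, h2⟩ := ho.split (addrs vs)
    refine ⟨k₂, k₁, ?_, ih hd (h1.mono ?_ le_rfl), by rw [add_comm, hw]⟩
    · intro a ha
      exact h2 a (Finset.mem_sdiff.2 ⟨mem_addrs.2 (by simp [ha]), hv a ha⟩)
    · intro a ha
      exact Finset.mem_inter.2 ⟨mem_addrs.2 (by simp [mem_addrs.1 ha]), ha⟩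

theorem permArgs_le {q : ℕ → ℚ} {vs : List Val} {h : Heap} (hs : permArgs q vs h) {i : ℕ}
    {a : Addr} (hi : vs[i]? = some (.loc a)) : q i ≤ h.perm (.addr a) := by
  induction vs generalizing h q i with
  | nil => simp at hi
  | cons v vs ih =>
    rw [permArgs_cons, star_iff] at hs
    obtain ⟨h₁, h₂, h1, h2, hw⟩ := hs
    rcases i with _ | i
    · exact (h1 a (by simpa using hi)).trans
        (perm_mono ((le_add_of_nonneg_right h₂.weight_nonneg).trans hw) _)
    · exact (ih h2 (by simpa using hi)).trans
        (perm_mono ((le_add_of_nonneg_left h₁.weight_nonneg).trans hw) _)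

/-- Full permission to distinct arguments splits into the permissions `q` and a remainder, which
restores full permission when the permissions `q` are given back. -/
theorem exists_permArgs_split {vs : List Val} (hd : DisjointVals vs) {q : ℕ → ℚ}
    (hq : ∀ i a, vs[i]? = some (.loc a) → q i ≤ 1) {h : Heap} (ho : Owns (addrs vs) h) :
    ∃ k r : Heap, k.weight + r.weight = h.weight ∧ permArgs q vs k ∧
      ∀ k' h' : Heap, permArgs q vs k' → k'.weight + r.weight ≤ h'.weight →
        Owns (addrs vs) h' := by
  induction vs generalizing h q with
  | nil => exact ⟨h, Heap.empty, by simp [Heap.weight_empty], trivial, by simp [Owns, addrs]⟩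
  | cons v vs ih =>
    obtain ⟨hv, hd⟩ := disjointVals_cons hd
    obtain ⟨g, f, hgf, hg, hf⟩ := ho.split (addrs vs)
    obtain ⟨k, r, hkr, hk, hr⟩ := ih hd (q := fun i => q (i + 1))
      (fun i a hi => hq (i + 1) a (by simpa using hi)) (h := g)
      (hg.mono (fun a ha => Finset.mem_inter.2 ⟨mem_addrs.2 (by simp [mem_addrs.1 ha]), ha⟩) le_rfl)
    have hcarve : ∃ k₁ k₂ : Heap, k₁.weight + k₂.weight = f.weight ∧ accNilFrac (q 0) v k₁ ∧
        ∀ g : Heap, accNilFrac (q 0) v g →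
          ∀ a, v = .loc a → 1 ≤ g.perm (.addr a) + k₂.perm (.addr a) := by
      by_cases hva : ∃ a, v = .loc a
      · obtain ⟨a, rfl⟩ := hva
        have hfa : f.perm (.addr a) = 1 :=
          hf a (Finset.mem_sdiff.2 ⟨mem_addrs.2 (by simp), hv a rfl⟩)
        have hq0 : q 0 ≤ 1 := hq 0 a (by simp)
        -- The amount `q 0` is an arbitrary rational and may be negative, so its maximum with 0 is
        -- lent.
        obtain ⟨k₁, k₂, hw, h1, -⟩ := exists_carve (h := f) (l := .addr a)
          (le_max_right (q 0) 0) (hfa ▸ max_le hq0 zero_le_one)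
        refine ⟨k₁, k₂, hw, ?_, ?_⟩
        · intro b hb
          cases hb
          exact h1 ▸ le_max_left _ _
        · intro g hg b hb
          cases hb
          have h2 := perm_add hw (.addr a)
          rw [h1, hfa] at h2
          rw [h2]
          exact add_le_add_left (max_le (hg a rfl) (perm_nonneg _ _)) _
      · exact ⟨f, Heap.empty, by simp [Heap.weight_empty], fun a ha => absurd ⟨a, ha⟩ hva,
          fun g _ a ha => absurd ⟨a, ha⟩ hva⟩
    obtain ⟨k₁, k₂, hw, h1, h2⟩ := hcarve
    have hsum : k₁.weight + k.weight + (k₂.weight + r.weight) = h.weight := by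
      rw [← hgf, ← hkr, ← hw]; abel
    obtain ⟨K, hK⟩ := exists_add_eq (hsum ▸ le_add_of_nonneg_right
      (add_nonneg k₂.weight_nonneg r.weight_nonneg))
    obtain ⟨R, hR⟩ := exists_add_eq (hsum ▸ le_add_of_nonneg_left
      (add_nonneg k₁.weight_nonneg k.weight_nonneg))
    refine ⟨K, R, by rw [hK, hR, hsum], ?_, ?_⟩
    · rw [permArgs_cons, star_iff]
      exact ⟨k₁, k, h1, hk, hK.ge⟩
    · intro k' h' hk' hle
      rw [permArgs_cons, star_iff] at hk'
      obtain ⟨g₁, g₂, hg₁, hg₂, hg⟩ := hk'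
      rw [hR] at hle
      have hle' : (g₁.weight + k₂.weight) + (g₂.weight + r.weight) ≤ h'.weight := by
        refine le_trans ?_ ((add_le_add_left hg _).trans hle)
        exact le_of_eq (by abel)
      intro a ha
      rcases List.mem_cons.1 (mem_addrs.1 ha) with hm | hm
      · refine le_antisymm (perm_le_one _ _) ((h2 g₁ hg₁ a hm.symm).trans ?_)
        exact perm_add_le ((le_add_of_nonneg_right
          (add_nonneg g₂.weight_nonneg r.weight_nonneg)).trans hle') _
      · exact hr g₂ h' hg₂ ((le_add_of_nonneg_left
          (add_nonneg g₁.weight_nonneg k₂.weight_nonneg)).trans hle') a (mem_addrs.2 hm)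

/-! ### Rules for safety -/

section Rules

variable {K : Type u} {core : CoreImpl K} {𝒯 : Set (Trace core)} {J : HProp}

/-- The requirement that safety imposes on the next step of a thread, in the memory `m`, under the
frame `hF`. -/
def SafeStep (𝒯 : Set (Trace core)) (J : HProp) (n : ℕ) (Q : Assn) (C : Cmd K) (σ : Store)
    (h hF : Heap) (m : Mem) : Prop :=
  ¬ C.Fault core σ m ∧
  (∀ l ∈ C.reads core σ, 0 < h.perm l) ∧
  (∀ l ∈ C.writes core σ, h.perm l = 1) ∧
  ∀ C' σ' m' t, Step core C σ m C' σ' m' t →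
    ∃ h' hT hJ', J hJ' ∧
      h'.weight + hT.weight + hJ'.weight + hF.weight = m'.toHeap.weight ∧
      Safe 𝒯 J n Q C' σ' h' ∧
      ∀ T ∈ t, Safe 𝒯 J n (fun _ _ => True) T.1 T.2 hT

theorem safe_succ {n : ℕ} {Q : Assn} {C : Cmd K} {σ : Store} {h : Heap} :
    Safe 𝒯 J (n + 1) Q C σ h ↔ (C = .skip → Q σ h) ∧
      ∀ hJ hF m, J hJ → h.weight + hJ.weight + hF.weight = m.toHeap.weight →
        Admissible 𝒯 C σ m → SafeStep 𝒯 J n Q C σ h hF m := by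
  simp only [Safe, SafeStep, joinAll_three, joinAll_four]

theorem safe_skip {Q : Assn} {σ : Store} {h : Heap} (hQ : Q σ h) (n : ℕ) :
    Safe 𝒯 J n Q (.skip : Cmd K) σ h := by
  rcases n with _ | n
  · trivial
  · refine safe_succ.2 ⟨fun _ => hQ, fun hJ hF m _ _ _ => ⟨id, ?_, ?_, ?_⟩⟩
    · rintro l ⟨⟩
    · rintro l ⟨⟩
    · rintro C' σ' m' t ⟨⟩

theorem safe_of_step {Q : Assn} {C : Cmd K} {σ : Store} {h : Heap} (hC : C ≠ .skip)
    (hs : ∀ n hJ hF m, J hJ → h.weight + hJ.weight + hF.weight = m.toHeap.weight →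
      Admissible 𝒯 C σ m → SafeStep 𝒯 J n Q C σ h hF m) (n : ℕ) : Safe 𝒯 J n Q C σ h := by
  rcases n with _ | n
  · trivial
  · exact safe_succ.2 ⟨fun h => absurd h hC, hs n⟩

/-- The frame rule, combined with the rule of consequence. -/
theorem Safe.frame {n : ℕ} {Q Q' : Assn} {C : Cmd K} {σ : Store} {h k r : Heap}
    (hs : Safe 𝒯 J n Q C σ h) (hw : h.weight + r.weight = k.weight)
    (hQ : ∀ σ' h' k', Q σ' h' → h'.weight + r.weight = k'.weight → Q' σ' k') :
    Safe 𝒯 J n Q' C σ k := by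
  induction n generalizing C σ h k with
  | zero => trivial
  | succ n ih =>
    obtain ⟨hskip, hstep⟩ := safe_succ.1 hs
    refine safe_succ.2 ⟨fun hC => hQ _ _ _ (hskip hC) hw, fun hJ hF m hJJ hm hadm => ?_⟩
    have hle : h.weight ≤ k.weight := hw ▸ le_add_of_nonneg_right r.weight_nonneg
    -- The framed heap `r` is hidden in the arbitrary frame, which every step leaves unchanged.
    obtain ⟨hF', hF'w⟩ : ∃ hF' : Heap, hF'.weight = r.weight + hF.weight := by
      refine exists_add_eq (h := m.toHeap) ?_
      rw [← hm, ← hw]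
      refine le_of_le_of_eq (le_add_of_nonneg_left (add_nonneg h.weight_nonneg hJ.weight_nonneg))
        (b := h.weight + hJ.weight + (r.weight + hF.weight)) ?_
      abel
    obtain ⟨h1, h2, h3, h4⟩ := hstep hJ hF' m hJJ (by rw [hF'w, ← hm, ← hw]; abel) hadm
    refine ⟨h1, fun l hl => (h2 l hl).trans_le (perm_mono hle l),
      fun l hl => perm_eq_one_of_le hle (h3 l hl), fun C' σ' m' t hst => ?_⟩
    obtain ⟨h', hT, hJ', hJJ', hw', hs', ht⟩ := h4 C' σ' m' t hst
    obtain ⟨k', hk'⟩ : ∃ k' : Heap, k'.weight = h'.weight + r.weight := by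
      refine exists_add_eq (h := m'.toHeap) ?_
      rw [← hw', hF'w]
      refine le_of_le_of_eq (le_add_of_nonneg_right (add_nonneg (add_nonneg hT.weight_nonneg
        hJ'.weight_nonneg) hF.weight_nonneg)) (a := h'.weight + r.weight) ?_
      abel
    exact ⟨k', hT, hJ', hJJ', by rw [hk', ← hw', hF'w]; abel, ih hs' hk'.symm, ht⟩

theorem Safe.conseq {n : ℕ} {Q Q' : Assn} {C : Cmd K} {σ : Store} {h : Heap}
    (hs : Safe 𝒯 J n Q C σ h) (hQ : ∀ σ' h', Q σ' h' → Q' σ' h') : Safe 𝒯 J n Q' C σ h := by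
  refine hs.frame (r := Heap.empty) (by rw [Heap.weight_empty, add_zero]) ?_
  intro σ' h' k' h hw
  rw [Heap.weight_empty, add_zero] at hw
  have : h' = k' := by
    have hj : Join h' Heap.empty k' := join_iff.2 (by rw [Heap.weight_empty, add_zero, hw])
    funext l
    have := hj l
    unfold JoinCell at this
    rcases hl : h' l with _ | ⟨p, v⟩ <;> simp [hl, Heap.empty] at this <;> exact this.symm
  exact hQ _ _ (this ▸ h)

theorem Safe.seq {R Q : Assn} {C₂ : Cmd K} (h₂ : ∀ n σ h, R σ h → Safe 𝒯 J n Q C₂ σ h)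
    {n : ℕ} {C₁ : Cmd K} {σ : Store} {h : Heap} (h₁ : Safe 𝒯 J n R C₁ σ h) :
    Safe 𝒯 J n Q (.seq C₁ C₂) σ h := by
  induction n generalizing C₁ σ h with
  | zero => trivial
  | succ n ih =>
    obtain ⟨hskip, hstep⟩ := safe_succ.1 h₁
    refine safe_succ.2 ⟨by rintro ⟨⟩, fun hJ hF m hJJ hm hadm => ?_⟩
    obtain ⟨h1, h2, h3, h4⟩ := hstep hJ hF m hJJ hm hadm
    refine ⟨h1, h2, h3, ?_⟩
    intro C' σ' m' t hst
    cases hst with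
    | seqSkip =>
      exact ⟨h, Heap.empty, hJ, hJJ, by rw [Heap.weight_empty, add_zero, hm],
        h₂ _ _ _ (hskip rfl), by rintro T ⟨⟩⟩
    | seq hst =>
      obtain ⟨h', hT, hJ', hJJ', hw', hs', ht⟩ := h4 _ _ _ _ hst
      exact ⟨h', hT, hJ', hJJ', hw', ih hs', ht⟩

/-- Only the next step of `C₁` in one memory is assumed. This is needed at the start of a statement,
whose side condition is known just for the current memory. -/
theorem SafeStep.seq {n : ℕ} {R Q : Assn} {C₁ C₂ : Cmd K} {σ : Store} {h hF : Heap} {m : Mem}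
    (hC : C₁ ≠ .skip) (hs : SafeStep 𝒯 J n R C₁ σ h hF m)
    (h₂ : ∀ n σ h, R σ h → Safe 𝒯 J n Q C₂ σ h) : SafeStep 𝒯 J n Q (.seq C₁ C₂) σ h hF m := by
  obtain ⟨h1, h2, h3, h4⟩ := hs
  refine ⟨h1, h2, h3, ?_⟩
  intro C' σ' m' t hst
  cases hst with
  | seqSkip => exact absurd rfl hC
  | seq hst =>
    obtain ⟨h', hT, hJ', hJJ', hw', hs', ht⟩ := h4 _ _ _ _ hst
    exact ⟨h', hT, hJ', hJJ', hw', hs'.seq h₂, ht⟩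

theorem SafeStep.ifPos {n : ℕ} {Q : Assn} {e : Expr} {C₁ C₂ : Cmd K} {σ : Store} {h hF : Heap}
    {m : Mem} (he : IsLocal σ e) (hs : SafeStep 𝒯 J n Q C₁ σ h hF m) :
    SafeStep 𝒯 J n Q (.ifLocal e C₁ C₂) σ h hF m := by
  obtain ⟨h1, h2, h3, h4⟩ := hs
  refine ⟨by simpa [Cmd.Fault, he] using h1, by simpa [Cmd.reads, he] using h2,
    by simpa [Cmd.writes, he] using h3, ?_⟩
  intro C' σ' m' t hst
  cases hst with
  | ifPos _ hst => exact h4 _ _ _ _ hst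
  | ifNeg hn _ => exact absurd he hn

theorem SafeStep.ifNeg {n : ℕ} {Q : Assn} {e : Expr} {C₁ C₂ : Cmd K} {σ : Store} {h hF : Heap}
    {m : Mem} (he : ¬ IsLocal σ e) (hs : SafeStep 𝒯 J n Q C₂ σ h hF m) :
    SafeStep 𝒯 J n Q (.ifLocal e C₁ C₂) σ h hF m := by
  obtain ⟨h1, h2, h3, h4⟩ := hs
  refine ⟨by simpa [Cmd.Fault, he] using h1, by simpa [Cmd.reads, he] using h2,
    by simpa [Cmd.writes, he] using h3, ?_⟩
  intro C' σ' m' t hst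
  cases hst with
  | ifPos hp _ => exact absurd hp he
  | ifNeg _ hst => exact h4 _ _ _ _ hst

/-- Side conditions enter here: admissibility of a labeled command places the current state on some
trace at that program point. -/
theorem safe_labeled {Q : Assn} {ℓ : Label} {C : Cmd K} {σ : Store} {h : Heap} (hC : C ≠ .skip)
    (hs : ∀ n hJ hF m, J hJ → h.weight + hJ.weight + hF.weight = m.toHeap.weight →
      AtPoint 𝒯 ℓ σ m → Admissible 𝒯 C σ m → SafeStep 𝒯 J n Q C σ h hF m) (n : ℕ) :
    Safe 𝒯 J n Q (.labeled ℓ C) σ h := by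
  refine safe_of_step (by rintro ⟨⟩) (fun n hJ hF m hJJ hm hadm => ?_) n
  obtain ⟨h1, h2, h3, h4⟩ := hs n hJ hF m hJJ hm (hadm ℓ (.inl rfl)) fun ℓ' h => hadm ℓ' (.inr h)
  refine ⟨h1, h2, h3, ?_⟩
  intro C' σ' m' t hst
  cases hst with
  | labeledSkip => exact absurd rfl hC
  | labeled hst => exact h4 _ _ _ _ hst

theorem safe_labeled_skip {Q : Assn} {ℓ : Label} {σ : Store} {h : Heap} (hQ : Q σ h) (n : ℕ) :
    Safe 𝒯 J n Q (.labeled ℓ .skip : Cmd K) σ h := by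
  refine safe_of_step (by rintro ⟨⟩) (fun n hJ hF m hJJ hm hadm => ⟨id, ?_, ?_, ?_⟩) n
  · rintro l ⟨⟩
  · rintro l ⟨⟩
  · intro C' σ' m' t hst
    cases hst with
    | labeledSkip =>
      exact ⟨h, Heap.empty, hJ, hJJ, by rw [Heap.weight_empty, add_zero, hm],
        safe_skip hQ n, by rintro T ⟨⟩⟩
    | labeled hst => cases hst

theorem safeStep_act {n : ℕ} {Q : Assn} {a : Act} {σ : Store} {h hF : Heap} {m : Mem}
    (hf : ¬ a.Fault σ m) (hr : ∀ l ∈ a.reads σ, 0 < h.perm l)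
    (hw : ∀ l ∈ a.writes σ, h.perm l = 1)
    (hs : ∀ σ' m', a.Run σ m σ' m' → ∃ h' hJ' : Heap, J hJ' ∧
      h'.weight + hJ'.weight + hF.weight = m'.toHeap.weight ∧ Q σ' h') :
    SafeStep 𝒯 J n Q (.act a : Cmd K) σ h hF m := by
  refine ⟨hf, hr, hw, ?_⟩
  intro C' σ' m' t hst
  cases hst with
  | act hrun =>
    obtain ⟨h', hJ', hJJ', hw', hQ⟩ := hs _ _ hrun
    exact ⟨h', Heap.empty, hJ', hJJ', by rw [Heap.weight_empty, add_zero, hw'],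
      safe_skip hQ n, by rintro T ⟨⟩⟩

theorem safeStep_atomic {n : ℕ} {Q : Assn} {as : List Act} {σ : Store} {h hF : Heap} {m : Mem}
    (hf : ¬ FaultAll as σ m)
    (hs : ∀ σ' m', RunAll as σ m σ' m' → ∃ h' hJ' : Heap, J hJ' ∧
      h'.weight + hJ'.weight + hF.weight = m'.toHeap.weight ∧ Q σ' h') :
    SafeStep 𝒯 J n Q (.atomic as : Cmd K) σ h hF m := by
  refine ⟨hf, by rintro l ⟨⟩, by rintro l ⟨⟩, ?_⟩
  intro C' σ' m' t hst
  cases hst with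
  | atomic hrun =>
    obtain ⟨h', hJ', hJJ', hw', hQ⟩ := hs _ _ hrun
    exact ⟨h', Heap.empty, hJ', hJJ', by rw [Heap.weight_empty, add_zero, hw'],
      safe_skip hQ n, by rintro T ⟨⟩⟩

/-- Ghost assignments to thread-local sets. -/
inductive Act.IsLocalGhost : Act → Prop
  | setSlh (A) : IsLocalGhost (.setSlh A)
  | setSih (A) : IsLocalGhost (.setSih A)
  | setTmp (A) : IsLocalGhost (.setTmp A)

theorem safeStep_localGhost {n : ℕ} {Q : Assn} {a : Act} (ha : a.IsLocalGhost) {σ : Store}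
    {h hJ hF : Heap} {m : Mem} (hJJ : J hJ)
    (hm : h.weight + hJ.weight + hF.weight = m.toHeap.weight)
    (hQ : ∀ σ', a.Run σ m σ' m → Q σ' h) :
    SafeStep 𝒯 J n Q (.act a : Cmd K) σ h hF m := by
  refine safeStep_act ?_ ?_ ?_ ?_
  · cases ha <;> exact id
  · cases ha <;> rintro l ⟨⟩
  · cases ha <;> rintro l ⟨⟩
  · intro σ' m' hrun
    have hmm : m' = m := by cases ha <;> exact hrun.2
    subst hmm
    exact ⟨h, hJ, hJJ, hm, hQ _ hrun⟩

theorem safe_localGhost {Q : Assn} {a : Act} (ha : a.IsLocalGhost) {σ : Store} {h : Heap}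
    (hQ : ∀ m σ', a.Run σ m σ' m → Q σ' h) (n : ℕ) :
    Safe 𝒯 J n Q (.act a : Cmd K) σ h :=
  safe_of_step (by rintro ⟨⟩) (fun _ _ _ m hJJ hm _ => safeStep_localGhost ha hJJ hm (hQ m)) n

/-- The parent keeps its whole heap; the child can obtain permissions only through the shared
invariant. -/
theorem safe_fork {Q : Assn} {xs : List Var} {C : Cmd K} {σ : Store} {h : Heap} (hQ : Q σ h)
    (hC : ∀ n, Safe 𝒯 J n (fun _ _ => True) C (σ.child xs) Heap.empty) (n : ℕ) :
    Safe 𝒯 J n Q (.fork xs C) σ h := by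
  refine safe_of_step (by rintro ⟨⟩) (fun n hJ hF m hJJ hm hadm => ⟨id, ?_, ?_, ?_⟩) n
  · rintro l ⟨⟩
  · rintro l ⟨⟩
  · intro C' σ' m' t hst
    cases hst with
    | fork =>
      refine ⟨h, Heap.empty, hJ, hJJ, by rw [Heap.weight_empty, add_zero, hm],
        safe_skip hQ n, ?_⟩
      rintro T ⟨⟩
      exact hC n

/-- A Core invocation changes the store only by assigning its results. -/
theorem Safe.coreRun_sets {n : ℕ} {Q : Assn} {q : K} {rs : List Var} {σ : Store} {h : Heap}
    (hs : Safe 𝒯 J n Q (.coreRun q rs) σ h) :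
    Safe 𝒯 J n (fun σ' h' => Q σ' h' ∧ ∃ vs, σ' = σ.sets rs vs) (.coreRun q rs) σ h := by
  induction n generalizing q h with
  | zero => trivial
  | succ n ih =>
    obtain ⟨-, hstep⟩ := safe_succ.1 hs
    refine safe_succ.2 ⟨by rintro ⟨⟩, fun hJ hF m hJJ hm hadm => ?_⟩
    obtain ⟨h1, h2, h3, h4⟩ := hstep hJ hF m hJJ hm hadm
    refine ⟨h1, h2, h3, ?_⟩
    intro C' σ' m' t hst
    obtain ⟨h', hT, hJ', hJJ', hw', hs', ht⟩ := h4 _ _ _ _ hst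
    refine ⟨h', hT, hJ', hJJ', hw', ?_, ht⟩
    cases hst with
    | coreStep => exact ih hs'
    | coreReturn =>
      rcases n with _ | n
      · trivial
      · exact safe_skip ⟨(safe_succ.1 hs').1 rfl, _, rfl⟩ _

/-- The Core's triple does not constrain the caller's ghost sets and other variables; that they are
preserved comes from the operational semantics. -/
theorem Safe.coreAlloc_sets {n : ℕ} {Q : Assn} {c : Var} {es : List Expr} {σ : Store} {h : Heap}
    (hs : Safe 𝒯 J n Q (.coreAlloc c es) σ h) :
    Safe 𝒯 J n (fun σ' h' => Q σ' h' ∧ ∃ vs, σ' = σ.sets [c] vs) (.coreAlloc c es) σ h := by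
  rcases n with _ | n
  · trivial
  obtain ⟨-, hstep⟩ := safe_succ.1 hs
  refine safe_succ.2 ⟨by rintro ⟨⟩, fun hJ hF m hJJ hm hadm => ?_⟩
  obtain ⟨h1, h2, h3, h4⟩ := hstep hJ hF m hJJ hm hadm
  refine ⟨h1, h2, h3, ?_⟩
  intro C' σ' m' t hst
  obtain ⟨h', hT, hJ', hJJ', hw', hs', ht⟩ := h4 _ _ _ _ hst
  refine ⟨h', hT, hJ', hJJ', hw', ?_, ht⟩
  cases hst
  exact hs'.coreRun_sets

theorem Safe.coreCall_sets {n : ℕ} {Q : Assn} {k : ℕ} {c : Var} {es : List Expr} {rs : List Var}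
    {σ : Store} {h : Heap} (hs : Safe 𝒯 J n Q (.coreCall k c es rs) σ h) :
    Safe 𝒯 J n (fun σ' h' => Q σ' h' ∧ ∃ vs, σ' = σ.sets rs vs) (.coreCall k c es rs) σ h := by
  rcases n with _ | n
  · trivial
  obtain ⟨-, hstep⟩ := safe_succ.1 hs
  refine safe_succ.2 ⟨by rintro ⟨⟩, fun hJ hF m hJJ hm hadm => ?_⟩
  obtain ⟨h1, h2, h3, h4⟩ := hstep hJ hF m hJJ hm hadm
  refine ⟨h1, h2, h3, ?_⟩
  intro C' σ' m' t hst
  obtain ⟨h', hT, hJ', hJJ', hw', hs', ht⟩ := h4 _ _ _ _ hst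
  refine ⟨h', hT, hJ', hJJ', hw', ?_, ht⟩
  cases hst
  exact hs'.coreRun_sets

/-- Running a command that needs the permissions `q` for arguments to which full permission is
held: the command returns what it was given, so that full permission is restored. -/
theorem safe_lend {n : ℕ} {Q : Assn} {C : Cmd K} {σ : Store} {q : ℕ → ℚ} {vs : List Val}
    {X : HProp} {Y : Assn} {Z : Store → Finset Addr} (hd : DisjointVals vs)
    (hq : Entails (accNilAll vs) (permArgs q vs))
    (hC : ∀ p, star X (permArgs q vs) p → Safe 𝒯 J n Q C σ p)
    (hQ : ∀ σ' p, Q σ' p → star (Y σ') (fun i => permArgs q vs i ∧ Owns (Z σ') i) p)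
    {f g r h : Heap} (hf : X f) (hg : Owns (addrs vs) g)
    (hw : f.weight + g.weight + r.weight = h.weight) :
    Safe 𝒯 J n (fun σ' h' => ∃ y g' : Heap, Y σ' y ∧ Owns (addrs vs ∪ Z σ') g' ∧
      y.weight + g'.weight + r.weight ≤ h'.weight) C σ h := by
  -- The heap `g` itself satisfies `permArgs q vs`, by `hq`, and no heap holds more than 1.
  have hq1 : ∀ i a, vs[i]? = some (.loc a) → q i ≤ 1 := fun i a hi =>
    (permArgs_le (hq _ (accNilAll_of_owns hd hg)) hi).trans (perm_le_one _ _)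
  obtain ⟨k, s, hks, hk, hs⟩ := exists_permArgs_split hd hq1 hg
  have hsum : (f.weight + k.weight) + (s.weight + r.weight) = h.weight := by
    rw [← hw, ← hks]; abel
  obtain ⟨p, hp⟩ := exists_add_eq (hsum ▸ le_add_of_nonneg_right
    (add_nonneg s.weight_nonneg r.weight_nonneg))
  -- The frame consists of the withheld part `s` of the arguments' permissions and the outer
  -- remainder `r`.
  obtain ⟨t, ht⟩ := exists_add_eq (hsum ▸ le_add_of_nonneg_left
    (add_nonneg f.weight_nonneg k.weight_nonneg))
  refine (hC p (star_iff.2 ⟨f, k, hf, hk, hp.ge⟩)).frame (r := t) (by rw [hp, ht, hsum]) ?_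
  intro σ' p' h' hQp hw'
  obtain ⟨y, i, hy, ⟨hi, hZ⟩, hle⟩ := star_iff.1 (hQ _ _ hQp)
  have hle' : y.weight + (i.weight + s.weight) + r.weight ≤ h'.weight := by
    rw [← hw', ht]
    refine le_trans (le_of_eq ?_) (add_le_add_left hle _)
    abel
  obtain ⟨g', hg'⟩ := exists_add_eq ((le_add_of_nonneg_left y.weight_nonneg).trans
    ((le_add_of_nonneg_right r.weight_nonneg).trans hle'))
  refine ⟨y, g', hy, ?_, by rw [hg']; exact hle'⟩
  intro a ha
  rcases Finset.mem_union.1 ha with ha | ha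
  · exact hs i g' hi hg'.ge a ha
  · exact perm_eq_one_of_le (hg' ▸ le_add_of_nonneg_right s.weight_nonneg) (hZ a ha)

end Rules

/-! ### Stores and expressions -/

theorem Expr.eval_congr {σ σ' : Store} {e : Expr} (h : ∀ x ∈ e.fv, σ'.vars x = σ.vars x) :
    e.eval σ' = e.eval σ := by
  induction e with
  | var x => exact h x rfl
  | const v => rfl
  | un f e ih => exact congrArg f (ih h)
  | bin f e₁ e₂ ih₁ ih₂ =>
    exact congrArg₂ f (ih₁ fun x hx => h x (.inl hx)) (ih₂ fun x hx => h x (.inr hx))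

theorem evals_congr {σ σ' : Store} {es : List Expr} (h : ∀ x ∈ fvs es, σ'.vars x = σ.vars x) :
    evals σ' es = evals σ es :=
  List.map_congr_left fun e he => Expr.eval_congr fun x hx => h x ⟨e, he, hx⟩

theorem Store.sets_spec (σ : Store) (rs : List Var) (vs : List Val) :
    (σ.sets rs vs).slh = σ.slh ∧ (σ.sets rs vs).sih = σ.sih ∧
      ∀ x, x ∉ rs → (σ.sets rs vs).vars x = σ.vars x := by
  induction rs generalizing σ vs with
  | nil => exact ⟨rfl, rfl, fun _ _ => rfl⟩
  | cons r rs ih =>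
    rcases vs with _ | ⟨v, vs⟩
    · exact ⟨rfl, rfl, fun _ _ => rfl⟩
    · obtain ⟨h1, h2, h3⟩ := ih (σ.set r v) vs
      refine ⟨h1, h2, fun x hx => ?_⟩
      rw [List.mem_cons, not_or] at hx
      exact (h3 x hx.2).trans (by simp [Store.set, hx.1])

theorem localInv_mono {inv : Val → HProp} {σ σ' : Store} {h h' : Heap} (hi : localInv inv σ h)
    (hl : σ'.slh ⊆ σ.slh) (hs : σ'.sih ⊆ σ.sih) (hw : h.weight ≤ h'.weight) :
    localInv inv σ' h' := by
  obtain ⟨h₁, h₂, h1, h2, hle⟩ := localInv_iff.1 hi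
  exact localInv_iff.2 ⟨h₁, h₂, h1.mono hl le_rfl, bigStar_mono h2 hs le_rfl, hle.trans hw⟩

/-! ### The invariants -/

theorem mem_of_owned {k h : Heap} {m : Mem} (hk : k.weight ≤ h.weight)
    (hm : h.weight ≤ m.toHeap.weight) {l : Loc} {v : l.Cell}
    (hl : k l = some (⟨1, by norm_num⟩, v)) : m l = some v :=
  mem_of_toHeap_eq_some (eq_some_of_le (hk.trans hm) hl)

theorem ne_none_of_perm {h : Heap} {m : Mem} (hm : h.weight ≤ m.toHeap.weight) {l : Loc}
    (hl : h.perm l = 1) : m l ≠ none := by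
  obtain ⟨v, hv⟩ := eq_some_of_perm hl
  simp [mem_of_owned le_rfl hm hv]

theorem OwnsShared.update_used {S : Finset Addr} {b : Bool} {j : Heap} (hj : OwnsShared S b j)
    (b' : Bool) : OwnsShared S b' (Function.update j .used (some (⟨1, by norm_num⟩, b'))) where
  sgh := by simpa using hj.sgh
  used := Function.update_self _ _ _
  owns a ha := by
    rw [Heap.perm_eq, Function.update_of_ne (by simp), ← Heap.perm_eq, hj.owns a ha]

theorem OwnsShared.update_sgh {S T : Finset Addr} {b : Bool} {j : Heap} (hj : OwnsShared S b j)
    (hT : Owns T j) : OwnsShared T b (Function.update j .sgh (some (⟨1, by norm_num⟩, T))) where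
  sgh := Function.update_self _ _ _
  used := by simpa using hj.used
  owns a ha := by
    rw [Heap.perm_eq, Function.update_of_ne (by simp), ← Heap.perm_eq, hT a ha]

theorem Owns.update {S : Finset Addr} {h : Heap} (hS : Owns S h) {a : Addr} {v : Val} :
    Owns (S ∪ {a}) (Function.update h (.addr a) (some (⟨1, by norm_num⟩, v))) := by
  intro b hb
  rw [Heap.perm_eq]
  by_cases hab : b = a
  · subst hab
    rw [Function.update_self]; rfl
  · rw [Function.update_of_ne (by simpa using hab), ← Heap.perm_eq]
    exact hS b (by simpa [hab] using hb)

theorem OwnsShared.update_addr {S : Finset Addr} {b : Bool} {j : Heap} (hj : OwnsShared S b j)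
    {a : Addr} {v : Val} :
    OwnsShared S b (Function.update j (.addr a) (some (⟨1, by norm_num⟩, v))) where
  sgh := by simpa using hj.sgh
  used := by simpa using hj.used
  owns := hj.owns.update.mono Finset.subset_union_left le_rfl

theorem OwnsShared.mono {S : Finset Addr} {b : Bool} {j k : Heap} (hj : OwnsShared S b j)
    (hw : j.weight ≤ k.weight) : OwnsShared S b k :=
  ⟨eq_some_of_le hw hj.sgh, eq_some_of_le hw hj.used, hj.owns.mono subset_rfl hw⟩

theorem sghSet_eq {m : Mem} {S : Finset Addr} (h : m .sgh = some S) : sghSet m = S := by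
  simp only [sghSet]
  rw [h]

/-- The memory `m` with `S` stored in the cell `sgh`. -/
def Mem.setSgh (m : Mem) (S : Finset Addr) : Mem := Function.update m .sgh (some S)

theorem sghSet_setSgh (m : Mem) (S : Finset Addr) : sghSet (m.setSgh S) = S :=
  sghSet_eq (Function.update_self _ _ _)

theorem Mem.setSgh_setSgh (m : Mem) (S T : Finset Addr) : (m.setSgh S).setSgh T = m.setSgh T :=
  Function.update_idem _ _ _

theorem Mem.setSgh_self {m : Mem} {S : Finset Addr} (h : m .sgh = some S) : m.setSgh S = m :=
  Function.update_eq_self_iff.2 h.symm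

/-- The memory `m` with `v` stored in the heap location `a`. -/
def Mem.setAddr (m : Mem) (a : Addr) (v : Val) : Mem := Function.update m (.addr a) (some v)

theorem Mem.setAddr_setSgh (m : Mem) (S : Finset Addr) (a : Addr) (v : Val) :
    (m.setSgh S).setAddr a v = (m.setAddr a v).setSgh S :=
  Function.update_comm (by simp) _ _ _

theorem OwnsShared.set_sgh {S T : Finset Addr} {b : Bool} {j : Heap} (hj : OwnsShared S b j)
    (hT : Owns T j) {m : Mem} {f : (l : Loc) → l.Cell → ℚ} (hf : 0 ≤ f)
    (hw : j.weight + f = m.toHeap.weight) :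
    ∃ j' : Heap, OwnsShared T b j' ∧ j'.weight + f = (m.setSgh T).toHeap.weight :=
  ⟨_, hj.update_sgh hT, weight_update hw hf (.inl (perm_of_eq_some hj.sgh)) T⟩

theorem addrs_loc (a : Addr) : addrs [Val.loc a] = {a} := by
  ext b; simp [mem_addrs]

theorem addrs_singleton_of_not_loc {v : Val} (hv : ¬ ∃ a, v = .loc a) : addrs [v] = ∅ := by
  ext b
  simp only [mem_addrs, List.mem_singleton, Finset.notMem_empty, iff_false]
  exact fun h => hv ⟨b, h.symm⟩

theorem exists_invNil {inv : Val → HProp} {S : Finset Addr} {v : Val} {h : Heap}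
    (hs : bigStar S (fun i => inv (.loc i)) h) (hv : (∃ a ∈ S, v = .loc a) ∨ v = .nil) :
    ∃ f k : Heap, invNil inv v f ∧ bigStar (S \ addrs [v]) (fun i => inv (.loc i)) k ∧
      f.weight + k.weight = h.weight := by
  rcases hv with ⟨a, ha, rfl⟩ | rfl
  · obtain ⟨f, k, hf, hk, hw⟩ := bigStar_remove hs ha
    exact ⟨f, k, fun _ => hf, by rwa [addrs_loc], hw⟩
  · exact ⟨Heap.empty, h, fun hn => absurd rfl hn, bigStar_mono hs Finset.sdiff_subset le_rfl,
      by rw [Heap.weight_empty, zero_add]⟩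

theorem bigStar_union_invNil {inv : Val → HProp} {S : Finset Addr} {v : Val} {h y k : Heap}
    (hs : bigStar S (fun i => inv (.loc i)) k) (hy : invNil inv v y)
    (hw : y.weight + k.weight ≤ h.weight) :
    bigStar (S ∪ addrs [v]) (fun i => inv (.loc i)) h := by
  by_cases hv : ∃ a, v = .loc a
  · obtain ⟨a, rfl⟩ := hv
    rw [addrs_loc]
    exact bigStar_insert (P := fun i => inv (.loc i)) (hy (by simp)) hs hw
  · rw [addrs_singleton_of_not_loc hv, Finset.union_empty]
    exact bigStar_mono hs subset_rfl ((le_add_of_nonneg_left y.weight_nonneg).trans hw)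

/-! ### The statements -/

section Statements

variable {K : Type u} {core : CoreImpl K} {𝒯 : Set (Trace core)} {φ : HProp}
  {inv : Val → HProp} {spec : CoreSpec}

theorem safe_alloc {ℓ : Label} {x : Var} {σ : Store} {h : Heap} (hi : localInv inv σ h) (n : ℕ) :
    Safe 𝒯 (globalInv φ) n (localInv inv) (instrument K (.alloc ℓ x)) σ h := by
  refine safe_labeled (by rintro ⟨⟩) (fun n hJ hF m hJJ hm _ _ => ?_) n
  -- The intermediate assertion already owns the new location, before the ghost assignment records
  -- it.
  refine SafeStep.seq (R := fun σ' h' => ∃ a, σ' = σ.set x (.loc a) ∧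
    localInv inv { σ with slh := σ.slh ∪ {a} } h') (by rintro ⟨⟩) (safeStep_act id
      (by rintro l ⟨⟩) (by rintro l ⟨⟩) ?_) ?_
  · rintro σ' m' ⟨a, ha, rfl, rfl⟩
    obtain ⟨h₁, h₂, h1, h2, hle⟩ := localInv_iff.1 hi
    obtain ⟨r, hr⟩ := exists_add_of_le ((le_add_of_nonneg_left h₁.weight_nonneg).trans hle)
    have h1r : Owns σ.slh r := h1.mono subset_rfl
      (by rw [← hr, add_comm] at hle; exact le_of_add_le_add_left hle)
    have hm' : r.weight + (h₂.weight + hJ.weight + hF.weight) = m.toHeap.weight := by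
      rw [← hm, ← hr]; abel
    have hup := weight_update hm' (add_nonneg (add_nonneg h₂.weight_nonneg hJ.weight_nonneg)
      hF.weight_nonneg) (.inr ha) Val.nil
    obtain ⟨h', hh'⟩ := exists_add_eq (h₁ := Function.update r (.addr a)
        (some (⟨1, by norm_num⟩, Val.nil))) (h₂ := h₂) (h := Mem.toHeap _) (by
      rw [← hup]
      refine le_of_le_of_eq (le_add_of_nonneg_right (add_nonneg hJ.weight_nonneg
        hF.weight_nonneg)) ?_
      abel)
    refine ⟨h', hJ, hJJ, ?_, a, rfl, localInv_iff.2 ⟨_, h₂, h1r.update, h2, hh'.ge⟩⟩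
    rw [hh', ← hup]; abel
  · rintro n _ h' ⟨a, rfl, hi'⟩
    refine safe_localGhost (.setSlh _) ?_ n
    rintro m σ' ⟨rfl, -⟩
    refine localInv_mono hi' ?_ subset_rfl le_rfl
    simp [GSet.eval, evals, Expr.eval, Store.set, addrs_loc]

/-! ### Reads and writes, local and shared. -/

theorem sdiff_union_singleton_subset {S : Finset Addr} {a : Addr} (ha : a ∈ S) :
    S \ {a} ∪ {a} ⊆ S := by
  simp [Finset.sdiff_union_self_eq_union, ha]

theorem perm_of_localInv {σ : Store} {h : Heap} (hi : localInv inv σ h) {a : Addr}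
    (ha : a ∈ σ.slh) : h.perm (.addr a) = 1 := by
  obtain ⟨h₁, h₂, h1, -, hle⟩ := localInv_iff.1 hi
  exact perm_eq_one_of_le ((le_add_of_nonneg_right h₂.weight_nonneg).trans hle) (h1 a ha)

theorem le_of_sum_eq {h hJ hF : Heap} {m : Mem}
    (hm : h.weight + hJ.weight + hF.weight = m.toHeap.weight) :
    h.weight ≤ m.toHeap.weight ∧ hJ.weight ≤ m.toHeap.weight := by
  rw [← hm]
  exact ⟨(le_add_of_nonneg_right hJ.weight_nonneg).trans (le_add_of_nonneg_right hF.weight_nonneg),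
    (le_add_of_nonneg_left h.weight_nonneg).trans (le_add_of_nonneg_right hF.weight_nonneg)⟩

theorem Expr.eval_set {x : Var} {e : Expr} (hx : x ∉ e.fv) (σ : Store) (v : Val) :
    e.eval (σ.set x v) = e.eval σ :=
  Expr.eval_congr fun _ hy => Function.update_of_ne (by rintro rfl; exact hx hy) _ _

theorem Expr.eval_ghost (σ : Store) (e : Expr) (A B C : Finset Addr) :
    e.eval ⟨σ.vars, A, B, C⟩ = e.eval σ :=
  Expr.eval_congr fun _ _ => rfl

theorem evals_ghost (σ : Store) (es : List Expr) (A B C : Finset Addr) :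
    evals ⟨σ.vars, A, B, C⟩ es = evals σ es :=
  evals_congr fun _ _ => rfl

/-- Because `x` does not occur in `e`, the location removed from `sgh` before the read is the one
added back after it. -/
theorem runAll_read {x : Var} {e : Expr} (hx : x ∉ e.fv) {σ σ' : Store} {m m' : Mem} {a : Addr}
    (ha : e.eval σ = .loc a)
    (hr : RunAll [.sghRem (.vals [e]), .read x e, .sghAdd (.vals [e])] σ m σ' m') :
    ∃ v, σ' = σ.set x v ∧ m' = (m.setSgh (sghSet m \ {a})).setSgh
      (sghSet (m.setSgh (sghSet m \ {a})) ∪ {a}) := by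
  obtain ⟨_, _, ⟨-, h₁, h₂⟩, _, _, ⟨_, v, -, -, h₃, h₄⟩, _, _, ⟨-, h₅, h₆⟩, h₇, h₈⟩ := hr
  have hA : ∀ m, GSet.eval σ m (.vals [e]) = {a} := fun m => by
    simp [GSet.eval, evals, ha, addrs_loc]
  have hB : ∀ m, GSet.eval (σ.set x v) m (.vals [e]) = {a} := fun m => by
    simp [GSet.eval, evals, Expr.eval_set hx, ha, addrs_loc]
  subst h₇ h₈ h₁
  rw [h₄] at h₆
  rw [h₃] at h₅ h₆
  rw [hB] at h₆
  rw [hA] at h₂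
  rw [h₂] at h₆
  exact ⟨v, h₅, h₆⟩

theorem runAll_write {x : Var} {e : Expr} {σ σ' : Store} {m m' : Mem} {a : Addr}
    (ha : σ.vars x = .loc a)
    (hr : RunAll [.sghRem (.vals [.var x]), .setTmp (.reachSlh [e]), .setSlh (.diff .slh .tmp),
      .write x e, .sghAdd (.union (.vals [.var x]) .tmp)] σ m σ' m') :
    ∃ D ⊆ σ.slh, ∃ v, σ' = { σ with slh := σ.slh \ D, tmp := D } ∧
      m' = ((m.setSgh (sghSet m \ {a})).setAddr a v).setSgh
        (sghSet ((m.setSgh (sghSet m \ {a})).setAddr a v) ∪ ({a} ∪ D)) := by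
  have hA : ∀ (A B C : Finset Addr) m, GSet.eval ⟨σ.vars, A, B, C⟩ m (.vals [.var x]) = {a} :=
    fun A B C m => by simp [GSet.eval, evals, Expr.eval, ha, addrs_loc]
  obtain ⟨σ₁, m₁, ⟨-, h₁, h₁'⟩, σ₂, m₂, ⟨h₂, h₂'⟩, σ₃, m₃, ⟨h₃, h₃'⟩, σ₄, m₄, ⟨b, hb, -, h₄, h₄'⟩,
    σ₅, m₅, ⟨-, h₅, h₅'⟩, h₆, h₆'⟩ := hr
  rw [hA] at h₁'
  have hD : GSet.eval σ₁ m₁ (.reachSlh [e]) ⊆ σ₁.slh := by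
    classical
    exact fun c hc => (Finset.mem_filter.1 hc).1
  -- Reachability is forgotten; only the inclusion in `slh` is kept.
  generalize GSet.eval σ₁ m₁ (.reachSlh [e]) = D at h₂ hD
  generalize e.eval σ₃ = v at h₄'
  subst h₁ h₆ h₆' h₂ h₃ h₄
  have hb : σ₁.vars x = .loc b := hb
  rw [ha] at hb
  cases hb
  subst h₂' h₃'
  refine ⟨D, hD, v, h₅, ?_⟩
  rw [h₅', h₄', GSet.eval, hA, h₁']
  rfl

/-- Moves the permissions for escaping locations from the thread to the shared part, without
touching the heap of `φ`. The updates of `sgh` and of the written cell are then carried out inside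
`g`. -/
theorem share {σ : Store} {h hJ hF : Heap} {m : Mem} (hi : localInv inv σ h)
    (hJJ : globalInv φ hJ) (hm : h.weight + hJ.weight + hF.weight = m.toHeap.weight) :
    ∃ S b, m .sgh = some S ∧ ∀ D ⊆ σ.slh, ∃ h' g j : Heap, OwnsShared S b g ∧ Owns D g ∧
      (b = false → φ j) ∧ localInv inv { σ with slh := σ.slh \ D } h' ∧
      g.weight + (h'.weight + j.weight + hF.weight) = m.toHeap.weight := by
  obtain ⟨S, b, j₁, j₂, hj, hφ, hjw⟩ := globalInv_iff.1 hJJ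
  refine ⟨S, b, mem_of_owned (hjw ▸ le_add_of_nonneg_right j₂.weight_nonneg)
    (le_of_sum_eq hm).2 hj.sgh, fun D hD => ?_⟩
  obtain ⟨h₁, h₂, h1, h2, hle⟩ := localInv_iff.1 hi
  obtain ⟨d, k, hdk, hd, hk⟩ := h1.split D
  rw [← hdk, add_assoc] at hle
  obtain ⟨h', hh'⟩ := exists_add_of_le ((le_add_of_nonneg_right
    (add_nonneg k.weight_nonneg h₂.weight_nonneg)).trans hle)
  rw [← hh'] at hle
  have hm' : (j₁.weight + d.weight) + (h'.weight + j₂.weight + hF.weight) = m.toHeap.weight := by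
    rw [← hm, ← hh', ← hjw]; abel
  obtain ⟨g, hg⟩ := exists_add_eq (hm' ▸ le_add_of_nonneg_right
    (add_nonneg (add_nonneg h'.weight_nonneg j₂.weight_nonneg) hF.weight_nonneg))
  refine ⟨h', g, j₂, hj.mono (hg ▸ le_add_of_nonneg_right d.weight_nonneg), hd.mono ?_
    (hg ▸ le_add_of_nonneg_left j₁.weight_nonneg), hφ, ?_, by rw [hg, hm']⟩
  · exact Finset.subset_inter hD subset_rfl
  · exact localInv_iff.2 ⟨k, h₂, hk, h2, le_of_add_le_add_left hle⟩

theorem exists_globalInv {S : Finset Addr} {b : Bool} {g h' j hF : Heap} {m' : Mem}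
    (hg : OwnsShared S b g) (hφ : b = false → φ j)
    (hm : g.weight + (h'.weight + j.weight + hF.weight) = m'.toHeap.weight) :
    ∃ hJ' : Heap, globalInv φ hJ' ∧
      h'.weight + hJ'.weight + hF.weight = m'.toHeap.weight := by
  obtain ⟨hJ', hJw⟩ := exists_add_eq (h₁ := g) (h₂ := j) (h := m'.toHeap) (by
    rw [← hm]
    refine le_of_le_of_eq (le_add_of_nonneg_right (add_nonneg h'.weight_nonneg
      hF.weight_nonneg)) ?_
    abel)
  exact ⟨hJ', globalInv_iff.2 ⟨S, b, g, j, hg, hφ, hJw.symm⟩, by rw [hJw, ← hm]; abel⟩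

theorem safe_read {ℓ : Label} {x : Var} {e : Expr} (hssa : x ∉ e.fv)
    (hω : Omega 𝒯 (.read ℓ x e)) {σ : Store} {h : Heap} (hi : localInv inv σ h) (n : ℕ) :
    Safe 𝒯 (globalInv φ) n (localInv inv) (instrument K (.read ℓ x e)) σ h := by
  refine safe_labeled (by rintro ⟨⟩) (fun n hJ hF m hJJ hm hat _ => ?_) n
  obtain ⟨a, ha, hea⟩ := hω σ m hat
  by_cases hl : IsLocal σ e
  · refine SafeStep.ifPos hl ?_
    have ha : a ∈ σ.slh := by
      obtain ⟨b, hb, heb⟩ := hl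
      rw [hea] at heb
      cases heb
      exact hb
    -- The invariant is kept for the original `slh`: removing `a` is bookkeeping only, and the
    -- permission to `a` is still owned.
    refine SafeStep.seq (R := fun σ' h' => σ' = { σ with slh := σ.slh \ {a} } ∧ localInv inv σ h')
      (by rintro ⟨⟩) (safeStep_localGhost (.setSlh _) hJJ hm ?_) ?_
    · rintro σ' ⟨rfl, -⟩
      exact ⟨by simp [GSet.eval, evals, hea, addrs_loc], hi⟩
    rintro n _ h ⟨rfl, hi⟩
    have hpa := perm_of_localInv hi ha
    have hea' : e.eval { σ with slh := σ.slh \ {a} } = .loc a :=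
      (Expr.eval_ghost ..).trans hea
    refine Safe.seq (R := fun σ' h' => (∃ v, σ' = { σ.set x v with slh := σ.slh \ {a} }) ∧
        localInv inv σ h')
      ?_ (safe_of_step (by rintro ⟨⟩) (fun n hJ hF m hJJ hm _ => safeStep_act ?_ ?_ ?_ ?_) n)
    · rintro n _ h ⟨⟨v, rfl⟩, hi⟩
      refine safe_localGhost (.setSlh _) ?_ n
      rintro m σ' ⟨rfl, -⟩
      refine localInv_mono hi ?_ subset_rfl le_rfl
      have hea'' : e.eval { σ.set x v with slh := σ.slh \ {a} } = .loc a :=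
        (Expr.eval_ghost ..).trans ((Expr.eval_set hssa σ v).trans hea)
      simp only [GSet.eval, evals, List.map_cons, List.map_nil]
      rw [hea'', addrs_loc]
      exact sdiff_union_singleton_subset ha
    · exact fun hf => hf ⟨a, hea', ne_none_of_perm (le_of_sum_eq hm).1 hpa⟩
    · rintro l ⟨b, hb, rfl⟩
      have hb : e.eval { σ with slh := σ.slh \ {a} } = .loc b := hb
      rw [hea'] at hb
      cases hb
      rw [hpa]; exact zero_lt_one
    · rintro l ⟨⟩
    · rintro σ' m' ⟨b, v, -, -, rfl, rfl⟩
      exact ⟨h, hJ, hJJ, hm, ⟨v, rfl⟩, hi⟩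
  · refine SafeStep.ifNeg hl ?_
    obtain ⟨S, b, j₁, j₂, hj, hφ, hjw⟩ := globalInv_iff.1 hJJ
    have hj1 : j₁.weight ≤ hJ.weight := hjw ▸ le_add_of_nonneg_right j₂.weight_nonneg
    have hsgh : m .sgh = some S := mem_of_owned hj1 (le_of_sum_eq hm).2 hj.sgh
    have haS : a ∈ S := by
      rw [sghSet_eq hsgh] at ha
      exact (Finset.mem_union.1 ha).resolve_left fun h => hl ⟨a, h, hea⟩
    have hma : m (.addr a) ≠ none :=
      ne_none_of_perm (hj1.trans (le_of_sum_eq hm).2) (hj.owns a haS)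
    refine safeStep_atomic ?_ ?_
    · rintro (hf | ⟨σ, _, ⟨-, rfl, rfl⟩, hf | ⟨_, _, ⟨_, v, -, -, rfl, rfl⟩, hf | ⟨_, _, -, ⟨⟩⟩⟩⟩)
      · exact absurd (hsgh.symm.trans hf) (by simp)
      · refine hf ⟨a, hea, ?_⟩
        rwa [Function.update_of_ne (by simp)]
      · simp [Act.Fault] at hf
    · intro σ' m' hrun
      obtain ⟨v, rfl, hm'⟩ := runAll_read hssa hea hrun
      refine ⟨h, hJ, hJJ, ?_, localInv_mono hi subset_rfl subset_rfl le_rfl⟩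
      -- The removal and addition cancel since `a ∈ S`, so the memory is unchanged and the old `hJ`
      -- still serves.
      rw [hm, hm', sghSet_setSgh, Mem.setSgh_setSgh, sghSet_eq hsgh,
        Finset.sdiff_union_self_eq_union,
        Finset.union_eq_left.2 (Finset.singleton_subset_iff.2 haS), Mem.setSgh_self hsgh]

theorem safe_write {ℓ : Label} {x : Var} {e : Expr}
    (hω : Omega 𝒯 (.write ℓ x e)) {σ : Store} {h : Heap} (hi : localInv inv σ h) (n : ℕ) :
    Safe 𝒯 (globalInv φ) n (localInv inv) (instrument K (.write ℓ x e)) σ h := by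
  refine safe_labeled (by rintro ⟨⟩) (fun n hJ hF m hJJ hm hat _ => ?_) n
  obtain ⟨a, ha, hxa⟩ := hω σ m hat
  by_cases hl : IsLocal σ (.var x)
  · refine SafeStep.ifPos hl ?_
    have ha : a ∈ σ.slh := by
      obtain ⟨b, hb, hxb⟩ := hl
      have hxb : σ.vars x = .loc b := hxb
      rw [hxa] at hxb
      cases hxb
      exact hb
    refine SafeStep.seq (R := fun σ' h' => σ' = { σ with slh := σ.slh \ {a} } ∧ localInv inv σ h')
      (by rintro ⟨⟩) (safeStep_localGhost (.setSlh _) hJJ hm ?_) ?_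
    · rintro σ' ⟨rfl, -⟩
      exact ⟨by simp [GSet.eval, evals, Expr.eval, hxa, addrs_loc], hi⟩
    rintro n _ h ⟨rfl, hi⟩
    have hpa := perm_of_localInv hi ha
    refine Safe.seq (R := fun σ' h' => σ' = { σ with slh := σ.slh \ {a} } ∧ localInv inv σ h')
      ?_ (safe_of_step (by rintro ⟨⟩) (fun n hJ hF m hJJ hm _ => safeStep_act ?_ ?_ ?_ ?_) n)
    · rintro n _ h' ⟨rfl, hi'⟩
      refine safe_localGhost (.setSlh _) ?_ n
      rintro m σ' ⟨rfl, -⟩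
      refine localInv_mono hi' ?_ subset_rfl le_rfl
      simp only [GSet.eval, evals, List.map_cons, List.map_nil, Expr.eval]
      rw [hxa, addrs_loc]
      exact sdiff_union_singleton_subset ha
    · exact fun hf => hf ⟨a, hxa, ne_none_of_perm (le_of_sum_eq hm).1 hpa⟩
    · rintro l ⟨⟩
    · rintro l ⟨b, hb, rfl⟩
      have hb : σ.vars x = .loc b := hb
      rw [hxa] at hb
      cases hb
      exact hpa
    · rintro σ' m' ⟨b, hb, -, rfl, rfl⟩
      have hb : σ.vars x = .loc b := hb
      rw [hxa] at hb
      cases hb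
      obtain ⟨h₁, h₂, h1, h2, hle⟩ := localInv_iff.1 hi
      -- The instances' heap `h₂` stays intact; the write happens in its complement `r`, which owns
      -- `slh`.
      obtain ⟨r, hr⟩ := exists_add_of_le ((le_add_of_nonneg_left h₁.weight_nonneg).trans hle)
      have h1r : Owns σ.slh r := h1.mono subset_rfl
        (by rw [← hr, add_comm] at hle; exact le_of_add_le_add_left hle)
      have hm' : r.weight + (h₂.weight + hJ.weight + hF.weight) = m.toHeap.weight := by
        rw [← hm, ← hr]; abel
      have hup := weight_update hm' (add_nonneg (add_nonneg h₂.weight_nonneg hJ.weight_nonneg)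
        hF.weight_nonneg) (.inl (h1r a ha)) (e.eval { σ with slh := σ.slh \ {a} })
      obtain ⟨h', hh'⟩ := exists_add_eq (h₁ := Function.update r (.addr a)
          (some (⟨1, by norm_num⟩, e.eval { σ with slh := σ.slh \ {a} }))) (h₂ := h₂)
          (h := Mem.toHeap _) (by
        rw [← hup]
        refine le_of_le_of_eq (le_add_of_nonneg_right (add_nonneg hJ.weight_nonneg
          hF.weight_nonneg)) ?_
        abel)
      refine ⟨h', hJ, hJJ, ?_, rfl, localInv_iff.2 ⟨_, h₂,
        h1r.update.mono Finset.subset_union_left le_rfl, h2, hh'.ge⟩⟩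
      rw [hh', ← hup]; abel
  · refine SafeStep.ifNeg hl ?_
    obtain ⟨S, b, j₁, j₂, hj, hφ, hjw⟩ := globalInv_iff.1 hJJ
    have hj1 : j₁.weight ≤ hJ.weight := hjw ▸ le_add_of_nonneg_right j₂.weight_nonneg
    have hsgh : m .sgh = some S := mem_of_owned hj1 (le_of_sum_eq hm).2 hj.sgh
    have haS : a ∈ S := by
      rw [sghSet_eq hsgh] at ha
      exact (Finset.mem_union.1 ha).resolve_left fun h => hl ⟨a, h, hxa⟩
    have hma : m (.addr a) ≠ none :=
      ne_none_of_perm (hj1.trans (le_of_sum_eq hm).2) (hj.owns a haS)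
    refine safeStep_atomic ?_ ?_
    · rintro (hf | ⟨σ, _, ⟨-, rfl, rfl⟩, hf | ⟨_, _, ⟨rfl, rfl⟩, hf | ⟨_, _, ⟨rfl, rfl⟩,
        hf | ⟨_, _, ⟨_, -, -, rfl, rfl⟩, hf | ⟨_, _, -, ⟨⟩⟩⟩⟩⟩⟩)
      · exact absurd (hsgh.symm.trans hf) (by simp)
      · exact hf
      · exact hf
      · refine hf ⟨a, hxa, ?_⟩
        rwa [Function.update_of_ne (by simp)]
      · simp [Act.Fault] at hf
    · intro σ' m' hrun
      obtain ⟨D, hD, v, rfl, rfl⟩ := runAll_write hxa hrun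
      obtain ⟨S', b', hS', hsh⟩ := share hi hJJ hm
      obtain rfl : S = S' := Option.some_injective _ (hsgh.symm.trans hS')
      obtain ⟨h', g, j, hg, hgD, hφ, hi', hw⟩ := hsh D hD
      have hnn := add_nonneg (add_nonneg h'.weight_nonneg j.weight_nonneg) hF.weight_nonneg
      have hw₁ := weight_update hw hnn (.inl (hg.owns a haS)) v
      have hg₁ := hg.update_addr (a := a) (v := v)
      -- The shared part must own everything that `sgh` will list: the old set, the written location
      -- and the escaping set.
      have hT : Owns (S \ {a} ∪ ({a} ∪ D)) (Function.update g (.addr a)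
          (some (⟨1, by norm_num⟩, v))) := by
        intro c hc
        rcases Finset.mem_union.1 hc with hc | hc
        · exact hg₁.owns c (Finset.mem_sdiff.1 hc).1
        rcases Finset.mem_union.1 hc with hc | hc
        · exact hgD.update c (Finset.mem_union_right _ hc)
        · exact hgD.update c (Finset.mem_union_left _ hc)
      obtain ⟨g₂, hg₂, hw₂⟩ := hg₁.set_sgh hT hnn hw₁
      rw [Mem.setAddr_setSgh, sghSet_setSgh, Mem.setSgh_setSgh, sghSet_eq hsgh]
      obtain ⟨hJ', hJJ', hw'⟩ := exists_globalInv hg₂ hφ hw₂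
      exact ⟨h', hJ', hJJ', hw', localInv_mono hi' subset_rfl subset_rfl le_rfl⟩

/-! ### Core invocations. -/

theorem evals_sets {σ : Store} {ws : List Var} {vs : List Val} {es : List Expr}
    (h : ∀ x ∈ fvs es, x ∉ ws) : evals (σ.sets ws vs) es = evals σ es :=
  evals_congr fun x hx => (σ.sets_spec ws vs).2.2 x (h x hx)

theorem permArgs_mono {q : ℕ → ℚ} {vs : List Val} {h k : Heap} (hs : permArgs q vs h)
    (hw : h.weight ≤ k.weight) : permArgs q vs k := by
  rcases vs with _ | ⟨v, vs⟩
  · trivial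
  · rw [permArgs_cons] at hs ⊢
    exact star_mono hs hw

/-- A Core invocation, followed by the ghost assignments that take back the arguments `es`, the
results and the instance. -/
theorem safe_core_block {C : Cmd K} {σ : Store} {es us : List Expr} {c : Var} {ws : List Var}
    {q : ℕ → ℚ} {X : HProp} {Q : Assn} {Z : Store → Finset Addr}
    (hd : DisjointVals (evals σ es))
    (hq : Entails (accNilAll (evals σ es)) (permArgs q (evals σ es)))
    (hC : ∀ n p, star X (permArgs q (evals σ es)) p →
      Safe 𝒯 (globalInv φ) n (fun σ' p => Q σ' p ∧ ∃ vs, σ' = σ.sets ws vs) C σ p)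
    (hQ : ∀ vs p, Q (σ.sets ws vs) p → star (invNil inv ((σ.sets ws vs).vars c))
      (fun i => permArgs q (evals σ es) i ∧ Owns (Z (σ.sets ws vs)) i) p)
    (hus : ∀ vs, addrs (evals (σ.sets ws vs) us) ⊆ addrs (evals σ es) ∪ Z (σ.sets ws vs))
    {f g k h₂ h : Heap} (hf : X f) (hg : Owns (addrs (evals σ es)) g) (hk : Owns σ.slh k)
    (h2 : bigStar σ.sih (fun i => inv (.loc i)) h₂)
    (hw : f.weight + g.weight + (k.weight + h₂.weight) ≤ h.weight) (n : ℕ) :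
    Safe 𝒯 (globalInv φ) n (localInv inv) (.seq C (.seq (.act (.setSlh (.union .slh (.vals us))))
      (.act (.setSih (.union .sih (.vals [.var c])))))) σ h := by
  obtain ⟨p, hp⟩ := exists_add_eq ((le_add_of_nonneg_right
    (add_nonneg k.weight_nonneg h₂.weight_nonneg)).trans hw)
  rw [← hp] at hw
  obtain ⟨r, hr⟩ := exists_add_of_le ((le_add_of_nonneg_right
    (add_nonneg k.weight_nonneg h₂.weight_nonneg)).trans hw)
  rw [← hr] at hw
  have hkr := le_of_add_le_add_left hw
  refine Safe.seq ?_ (safe_lend (Y := fun σ' y => (∃ vs, σ' = σ.sets ws vs) ∧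
    invNil inv (σ'.vars c) y) (Z := Z) hd hq (hC n) ?_ hf hg (by rw [← hp, hr]))
  · rintro n _ h' ⟨y, g', ⟨⟨vs, rfl⟩, hy⟩, hg', hw'⟩
    obtain ⟨hslh, hsih, -⟩ := σ.sets_spec ws vs
    have hle : g'.weight + k.weight + (y.weight + h₂.weight) ≤ h'.weight := by
      refine le_trans ?_ ((add_le_add_right hkr _).trans hw')
      exact le_of_eq (by abel)
    obtain ⟨l₁, hl₁⟩ := exists_add_eq ((le_add_of_nonneg_right
      (add_nonneg y.weight_nonneg h₂.weight_nonneg)).trans hle)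
    obtain ⟨l₂, hl₂⟩ := exists_add_eq ((le_add_of_nonneg_left
      (add_nonneg g'.weight_nonneg k.weight_nonneg)).trans hle)
    -- The invariant is proved at once for the final ghost sets; the two remaining assignments only
    -- install them. Other store components are irrelevant to it.
    have hI : localInv inv { σ with
        slh := (σ.sets ws vs).slh ∪ addrs (evals (σ.sets ws vs) us)
        sih := (σ.sets ws vs).sih ∪ addrs [(σ.sets ws vs).vars c] } h' := by
      refine localInv_iff.2 ⟨l₁, l₂, ?_, ?_, by rw [hl₁, hl₂]; exact hle⟩
      · intro a ha
        rcases Finset.mem_union.1 ha with ha | ha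
        · exact perm_eq_one_of_le (hl₁ ▸ le_add_of_nonneg_left g'.weight_nonneg)
            (hk a (hslh ▸ ha))
        · exact perm_eq_one_of_le (hl₁ ▸ le_add_of_nonneg_right k.weight_nonneg)
            (hg' a (hus vs ha))
      · exact bigStar_union_invNil (hsih.symm ▸ h2) hy hl₂.ge
    refine Safe.seq (R := fun σ' h => σ' = { σ.sets ws vs with
      slh := (σ.sets ws vs).slh ∪ addrs (evals (σ.sets ws vs) us) } ∧ h = h') ?_
      (safe_localGhost (.setSlh _) ?_ n)
    · rintro n _ _ ⟨rfl, rfl⟩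
      refine safe_localGhost (.setSih _) ?_ n
      rintro m σ' ⟨rfl, -⟩
      exact localInv_mono hI subset_rfl subset_rfl le_rfl
    · rintro m σ' ⟨rfl, -⟩
      exact ⟨rfl, rfl⟩
  · rintro σ' p ⟨hp, vs, rfl⟩
    obtain ⟨p₁, p₂, hp₁, hp₂, hle⟩ := star_iff.1 (hQ vs p hp)
    exact star_iff.2 ⟨p₁, p₂, ⟨⟨vs, rfl⟩, hp₁⟩, hp₂, hle⟩

theorem safe_coreAlloc (hspec : spec.Restricted) {ℓ : Label} {c : Var} {es : List Expr}
    (hssa : c ∉ fvs es) (hcore : CoreVerified 𝒯 spec φ inv (.coreAlloc ℓ c es))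
    (hω : Omega 𝒯 (.coreAlloc ℓ c es)) {σ : Store} {h : Heap} (hi : localInv inv σ h) (n : ℕ) :
    Safe 𝒯 (globalInv φ) n (localInv inv) (instrument K (.coreAlloc ℓ c es)) σ h := by
  refine safe_labeled (by rintro ⟨⟩) (fun n hJ hF m hJJ hm hat _ => ?_) n
  obtain ⟨hused, hes, hdis⟩ := hω σ m hat
  refine SafeStep.seq (R := fun σ' h' => σ' = σ ∧ ∃ f : Heap, φ f ∧
    h.weight + f.weight = h'.weight) (by rintro ⟨⟩) (safeStep_atomic ?_ ?_) ?_
  · rintro (hf | ⟨_, _, -, ⟨⟩⟩)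
    exact absurd (hused.symm.trans hf) (by simp)
  · rintro σ' m' ⟨_, _, ⟨-, hσ', rfl⟩, hσ'', rfl⟩
    obtain rfl : σ' = σ := hσ''.trans hσ'
    obtain ⟨S, b, j₁, j₂, hj, hφ, hjw⟩ := globalInv_iff.1 hJJ
    have hb : m .used = some b := mem_of_owned (hjw ▸ le_add_of_nonneg_right j₂.weight_nonneg)
      (le_of_sum_eq hm).2 hj.used
    -- The side condition identifies the flag, so `j₂` satisfies `φ` and can be handed to the
    -- thread.
    obtain rfl : b = false := Option.some_injective _ (hb.symm.trans hused)
    have hm' : j₁.weight + (h.weight + j₂.weight + hF.weight) = m.toHeap.weight := by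
      rw [← hm, ← hjw]; abel
    have hw := weight_update hm' (add_nonneg (add_nonneg h.weight_nonneg j₂.weight_nonneg)
      hF.weight_nonneg) (l := .used) (.inl (perm_of_eq_some hj.used)) true
    obtain ⟨h', hh'⟩ := exists_add_eq (h₁ := h) (h₂ := j₂) (h := m.toHeap) (by
      rw [← hm']
      exact (le_add_of_nonneg_right hF.weight_nonneg).trans
        (le_add_of_nonneg_left j₁.weight_nonneg))
    -- With the flag set, the implication guarding `φ` is vacuous and the empty heap witnesses it.
    refine ⟨h', Function.update j₁ .used (some (⟨1, by norm_num⟩, true)), globalInv_iff.2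
      ⟨S, true, _, Heap.empty, hj.update_used true, by simp, ?_⟩, ?_, rfl, j₂, hφ rfl, hh'.symm⟩
    · rw [Heap.weight_empty, add_zero]
    · refine Eq.trans ?_ hw
      rw [hh']; abel
  rintro n σ' h' ⟨hσ', f, hf, hw⟩
  subst σ'
  obtain ⟨h₁, h₂, h1, h2, hle⟩ := localInv_iff.1 hi
  obtain ⟨g, k, hgk, hg, hk⟩ := h1.split (addrs (evals σ es))
  refine Safe.seq (R := fun σ' k => σ' = { σ with slh := σ.slh \ addrs (evals σ es) } ∧
    h'.weight ≤ k.weight) ?_ (safe_localGhost (.setSlh _) ?_ n)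
  swap
  · rintro m σ' ⟨rfl, -⟩
    exact ⟨rfl, le_rfl⟩
  rintro n _ h'' ⟨rfl, hw'⟩
  have hev := evals_ghost σ es (σ.slh \ addrs (evals σ es)) σ.sih σ.tmp
  have hc : ∀ x ∈ fvs es, x ∉ [c] := fun x hx hxc => hssa (List.mem_singleton.1 hxc ▸ hx)
  refine safe_core_block (σ := { σ with slh := σ.slh \ addrs (evals σ es) }) (es := es)
    (q := spec.allocPerm) (X := φ) (ws := [c]) (Z := fun _ => ∅)
    (f := f) (g := g) (k := k) (h₂ := h₂) (by rwa [hev]) (hspec.allocPre _)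
    (fun n p hp => (hcore n _ p hp).coreAlloc_sets) ?_ ?_ hf ?_ hk h2 ?_ n
  · intro vs p hp
    have hev' := evals_sets (σ := { σ with slh := σ.slh \ addrs (evals σ es) }) (ws := [c])
      (vs := vs) (es := es) hc
    rw [star_iff] at hp ⊢
    obtain ⟨p₁, p₂, hp₁, hp₂, hle⟩ := hp
    rw [hev'] at hp₂
    exact ⟨p₁, p₂, fun _ => hp₁, ⟨hspec.allocPost _ _ _ hp₂, by simp [Owns]⟩, hle⟩
  · intro vs
    rw [evals_sets hc]
    exact Finset.subset_union_left
  · rw [hev]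
    exact hg.mono (Finset.subset_inter hes subset_rfl) le_rfl
  · refine le_trans ?_ hw'
    rw [← hw, add_comm h.weight]
    refine le_trans ?_ (add_le_add_right hle _)
    rw [← hgk]
    exact le_of_eq (by abel)

theorem safe_coreCall (hspec : spec.Restricted) {ℓ : Label} {i : ℕ} {c : Var} {es : List Expr}
    {rs : List Var} (hes : ∀ r ∈ rs, r ∉ fvs es)
    (hcore : CoreVerified 𝒯 spec φ inv (.coreCall ℓ i c es rs))
    (hω : Omega 𝒯 (.coreCall ℓ i c es rs)) {σ : Store} {h : Heap} (hi : localInv inv σ h) (n : ℕ) :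
    Safe 𝒯 (globalInv φ) n (localInv inv) (instrument K (.coreCall ℓ i c es rs)) σ h := by
  refine safe_labeled (by rintro ⟨⟩) (fun n hJ hF m hJJ hm hat _ => ?_) n
  obtain ⟨hsub, hdis, hcs⟩ := hω σ m hat
  refine SafeStep.seq (R := fun σ' h' => σ' = { σ with sih := σ.sih \ addrs [σ.vars c] } ∧
    h' = h) (by rintro ⟨⟩) (safeStep_localGhost (.setSih _) hJJ hm ?_) ?_
  · rintro σ' ⟨rfl, -⟩
    exact ⟨rfl, rfl⟩
  rintro n _ _ ⟨rfl, rfl⟩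
  refine Safe.seq (R := fun σ' h' => σ' = { σ with
      slh := σ.slh \ addrs (evals σ es), sih := σ.sih \ addrs [σ.vars c] } ∧ localInv inv σ h')
    ?_ (safe_localGhost (.setSlh _) ?_ n)
  swap
  · rintro m σ' ⟨rfl, -⟩
    refine ⟨?_, hi⟩
    simp only [GSet.eval, evals_ghost]
  rintro n _ h ⟨rfl, hi⟩
  obtain ⟨h₁, h₂, h1, h2, hle⟩ := localInv_iff.1 hi
  obtain ⟨g, k, hgk, hg, hk⟩ := h1.split (addrs (evals σ es))
  -- The instance's invariant is taken out of the iterated conjunction; for a nil instance nothing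
  -- is taken.
  obtain ⟨f, h₂', hf, h2', hfw⟩ := exists_invNil h2 hcs
  have hev := evals_ghost σ es (σ.slh \ addrs (evals σ es)) (σ.sih \ addrs [σ.vars c]) σ.tmp
  have hrs : ∀ x ∈ fvs es, x ∉ rs := fun x hx hr => hes x hr hx
  refine safe_core_block (σ := { σ with
      slh := σ.slh \ addrs (evals σ es), sih := σ.sih \ addrs [σ.vars c] }) (es := es)
    (q := spec.callPerm i) (X := invNil inv (σ.vars c)) (ws := rs)
    (Z := fun σ' => addrs (rs.map σ'.vars)) (f := f) (g := g) (k := k) (h₂ := h₂')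
    (by rwa [hev]) (hspec.callPre _ _)
    (fun n p hp => (hcore n _ p hp).coreCall_sets) ?_ ?_ hf ?_ hk h2' ?_ n
  · intro vs p hp
    rw [star_iff] at hp ⊢
    obtain ⟨p₁, p₂, hp₁, hp₂, hle⟩ := hp
    rw [evals_sets hrs] at hp₂
    obtain ⟨i₁, i₂, hi₁, hi₂, hil⟩ := star_iff.1 (hspec.callPost _ _ _ _ _ hp₂)
    refine ⟨p₁, p₂, hp₁, ⟨?_, ?_⟩, hle⟩
    · exact permArgs_mono hi₁ ((le_add_of_nonneg_right i₂.weight_nonneg).trans hil)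
    · exact (accNilAll_owns hi₂).mono subset_rfl
        ((le_add_of_nonneg_left i₁.weight_nonneg).trans hil)
  · intro vs a ha
    rw [mem_addrs, evals, List.map_append, List.mem_append, ← evals, evals_sets hrs,
      List.map_map] at ha
    rw [Finset.mem_union, mem_addrs, mem_addrs]
    exact ha
  · rw [hev]
    exact hg.mono (Finset.subset_inter hsub subset_rfl) le_rfl
  · refine le_trans ?_ hle
    rw [← hgk, ← hfw]
    exact le_of_eq (by abel)

/-! ### Fork, and the induction on derivations. -/

theorem safe_forkStmt {ℓ : Label} {xs : List Var} {s : Stmt}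
    (ih : ∀ n σ h, localInv inv σ h → Safe 𝒯 (globalInv φ) n (localInv inv) (instrument K s) σ h)
    {σ : Store} {h : Heap} (hi : localInv inv σ h) (n : ℕ) :
    Safe 𝒯 (globalInv φ) n (localInv inv) (instrument K (.fork ℓ xs s)) σ h := by
  refine safe_labeled (by rintro ⟨⟩) (fun n hJ hF m hJJ hm hat _ => ?_) n
  refine SafeStep.seq (R := fun σ' h' => ∃ D ⊆ σ.slh, σ' = { σ with tmp := D } ∧
    localInv inv σ h') (by rintro ⟨⟩) (safeStep_localGhost (.setTmp _) hJJ hm ?_) ?_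
  · rintro σ' ⟨rfl, -⟩
    exact ⟨_, by classical exact Finset.filter_subset _ _, rfl, hi⟩
  rintro n _ h ⟨D, hD, rfl, hi⟩
  refine Safe.seq (R := fun σ' h' => σ' = { σ with slh := σ.slh \ D, tmp := D } ∧
    localInv inv σ h') ?_ (safe_localGhost (.setSlh _) ?_ n)
  swap
  · rintro m σ' ⟨rfl, -⟩
    exact ⟨rfl, hi⟩
  rintro n _ h ⟨rfl, hi⟩
  refine Safe.seq (R := localInv inv) ?_ (safe_of_step (by rintro ⟨⟩)
    (fun n hJ hF m hJJ hm _ => safeStep_atomic ?_ ?_) n)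
  · intro n σ h hi
    refine safe_fork hi (fun n => ?_) n
    -- The child inherits copies of the parent's ghost sets but none of its permissions; its local
    -- invariant holds only once both sets are emptied.
    refine Safe.seq (R := fun σ' _ => σ'.slh = ∅) ?_ (safe_localGhost (.setSlh _) ?_ n)
    · intro n σ h hσ
      refine Safe.seq (R := localInv inv) ?_ (safe_localGhost (.setSih _) ?_ n)
      · exact fun n σ h hi => (ih n σ h hi).conseq fun _ _ _ => trivial
      · rintro m σ' ⟨rfl, -⟩
        refine localInv_iff.2 ⟨Heap.empty, Heap.empty, ?_, ?_, ?_⟩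
        · rw [show ({ σ with sih := GSet.empty.eval σ m } : Store).slh = ∅ from hσ]
          simp [Owns]
        · exact bigStar_iff.2 ⟨fun _ => Heap.empty, by simp [GSet.eval], by
            simp [GSet.eval, Heap.weight_empty]⟩
        · simpa [Heap.weight_empty] using h.weight_nonneg
    · rintro m σ' ⟨rfl, -⟩
      rfl
  · obtain ⟨S, b, hS, -⟩ := share hi hJJ hm
    rintro (hf | ⟨_, _, -, ⟨⟩⟩)
    exact absurd (hS.symm.trans hf) (by simp)
  · rintro σ' m' ⟨_, _, ⟨-, rfl, hm'⟩, rfl, rfl⟩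
    obtain ⟨S, b, hS, hsh⟩ := share hi hJJ hm
    obtain ⟨h', g, j, hg, hgD, hφ, hi', hw⟩ := hsh D hD
    have hT : Owns (S ∪ D) g := fun c hc => (Finset.mem_union.1 hc).elim (hg.owns c) (hgD c)
    obtain ⟨g₂, hg₂, hw₂⟩ := hg.set_sgh hT
      (add_nonneg (add_nonneg h'.weight_nonneg j.weight_nonneg) hF.weight_nonneg) hw
    obtain ⟨hJ', hJJ', hw'⟩ := exists_globalInv hg₂ hφ hw₂
    have hm' : m' = m.setSgh (sghSet m ∪ D) := hm'
    rw [sghSet_eq hS] at hm'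
    exact ⟨h', hJ', hJJ', hm' ▸ hw', localInv_mono hi' subset_rfl subset_rfl le_rfl⟩

theorem Derivable.safe (hspec : spec.Restricted) {s : Stmt} (hs : Derivable 𝒯 s) (hssa : s.IsSSA)
    (hcore : CoreVerified 𝒯 spec φ inv s) (n : ℕ) (σ : Store) (h : Heap)
    (hi : localInv inv σ h) :
    Safe 𝒯 (globalInv φ) n (localInv inv) (instrument K s) σ h := by
  induction hs generalizing n σ h with
  | @simple s hsimple hω =>
    cases s with
    | skip ℓ => exact safe_labeled_skip hi n
    | alloc ℓ x => exact safe_alloc hi n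
    | read ℓ x e => exact safe_read (Set.disjoint_singleton_left.1 hssa) hω hi n
    | write ℓ x e => exact safe_write hω hi n
    | coreAlloc ℓ c es =>
      exact safe_coreAlloc hspec (Set.disjoint_singleton_left.1 hssa) hcore hω hi n
    | coreCall ℓ i c es rs =>
      have hd := Set.disjoint_left.1 hssa.2
      exact safe_coreCall hspec (fun r hr he => hd hr (.inr he))
        hcore hω hi n
    | seq => exact hsimple.elim
    | fork => exact hsimple.elim
  | seq _ _ ih₁ ih₂ =>
    refine safe_labeled (by rintro ⟨⟩) (fun n hJ hF m hJJ hm _ hadm => ?_) n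
    -- The label costs no step of its own, so the step requirement of the inner composition, safe
    -- for `n + 1` steps, is reused directly.
    exact (safe_succ.1 ((ih₁ hssa.1 hcore.1 (n + 1) σ h hi).seq
      (ih₂ hssa.2.1 hcore.2))).2 hJ hF m hJJ hm hadm
  | fork _ ih => exact safe_forkStmt (ih hssa.1 hcore) hi n

end Statements

end CoreApp

theorem mainTheorem3 {K : Type u} (core : CoreApp.CoreImpl K) (𝒯 : Set (CoreApp.Trace core))
    (φ : CoreApp.HProp) (inv : CoreApp.Val → CoreApp.HProp)
    (spec : CoreApp.CoreSpec) (hspec : spec.Restricted)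
    (s : CoreApp.Stmt) (hssa : s.IsSSA)
    (hcore : CoreApp.CoreVerified 𝒯 spec φ inv s)
    (hs : CoreApp.Derivable 𝒯 s) :
    CoreApp.Valid 𝒯 (CoreApp.globalInv φ) (CoreApp.localInv inv)
      (CoreApp.instrument K s) (CoreApp.localInv inv) :=
  fun n σ h hi => hs.safe hspec hssa hcore n σ h hi
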